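/- Let $n\ge 2$, $k>2$, and let $h\in\mathbb C[z_1,\dots,z_n]$ be a homogeneous polynomial of degree $k$ whose only critical point is $\mathbf 0$. Let $\mathcal H$ be the codimension-one holomorphic foliation of $\mathbb C^n$ (singular at $\mathbf 0$) defined by $dh$: its leaves are the connected components of the sets $h^{-1}(c)\setminus\{\mathbf 0\}$, $c\in\mathbb C$. Let $\mathcal H_k$ be the foliation defined in the same way by the Fermat polynomial $H^n_k=z_1^k+\dots+z_n^k$, and let $Q(z)=|z_1|^2+\dots+|z_n|^2$. We say that $\mathcal H$ carries a Morse structure compatible with a function $g:\mathbb C^n\to\mathbb R$, smooth on $\mathbb C^n\setminus\{\mathbf 0\}$, if the restriction of $g$ to each leaf of $\mathcal H$ is a Morse function, i.e. its critical points are non-degenerate and its critical values are isolated. Then: (1) $\mathcal H$ is isotopic to $\mathcal H_k$: there is an isotopy $(\Phi_t)_{t\in[0,1]}$ of $\mathbb C^n$ by homeomorphisms fixing $\mathbf 0$, with $\Phi_0=\mathrm{id}$, which restricts to a $C^\infty$ isotopy of $\mathbb C^n\setminus\{\mathbf 0\}$ by diffeomorphisms, such that $\Phi_1$ maps the leaves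 of $\mathcal H$ onto the leaves of $\mathcal H_k$. Moreover $\Phi_1$ can be chosen so that $\mathcal H$ carries a Morse structure compatible with the function $Q\circ\Phi_1$ (which is smooth away from $\mathbf 0$). (2) $\mathcal H$ carries a Morse structure compatible with a Morse function isotopic to $Q$: there is a real analytic function $g:\mathbb C^n\to\mathbb R$ whose only critical point is $\mathbf 0$, non-degenerate of Morse index $0$, such that $g=Q\circ\Psi_1$ for some $C^\infty$ isotopy $(\Psi_t)_{t\in[0,1]}$ of $\mathbb C^n$ by diffeomorphisms fixing $\mathbf 0$ with $\Psi_0=\mathrm{id}$, and such that the restriction of $g$ to each leaf of $\mathcal H$ is a Morse function. -/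

import Mathlib

open scoped ContDiff

namespace HolFol

/-- Complex `n`-space with its usual Hermitian norm. -/
abbrev Cn (n : ℕ) : Type := EuclideanSpace ℂ (Fin n)

/-- The function on `ℂⁿ` given by a polynomial. -/
noncomputable def polyFun {n : ℕ} (h : MvPolynomial (Fin n) ℂ) (z : Cn n) : ℂ :=
  MvPolynomial.eval (fun i => z i) h

/-- The Fermat polynomial `z₁ᵏ + ⋯ + zₙᵏ`. -/
noncomputable def fermat (n k : ℕ) : MvPolynomial (Fin n) ℂ :=
  ∑ i, MvPolynomial.X i ^ k

/-- The origin is the unique critical point of the polynomial `h`. -/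
def HasUniqueCriticalPointZero {n : ℕ} (h : MvPolynomial (Fin n) ℂ) : Prop :=
  ∀ z : Cn n,
    (∀ j, MvPolynomial.eval (fun i => z i) (MvPolynomial.pderiv j h) = 0) ↔ z = 0

/-- The leaf through `z` of the foliation of `ℂⁿ ∖ {0}` with first integral `f`: the connected
component containing `z` of the fibre of `f` through `z`, with the origin removed. -/
def leaf {n : ℕ} (f : Cn n → ℂ) (z : Cn n) : Set (Cn n) :=
  connectedComponentIn {w | w ≠ 0 ∧ f w = f z} z

/-- The codimension-one foliation of `ℂⁿ`, singular at the origin, with first integral `f`,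
given as the set of its leaves. -/
def foliation {n : ℕ} (f : Cn n → ℂ) : Set (Set (Cn n)) :=
  {L | ∃ z, z ≠ 0 ∧ L = leaf f z}

/-- The map `F` carries the foliation `𝓕` onto the foliation `𝓖`, leaf by leaf. -/
def CarriesFoliation {n : ℕ} (F : Cn n → Cn n) (𝓕 𝓖 : Set (Set (Cn n))) : Prop :=
  (fun L => F '' L) '' 𝓕 = 𝓖

/-- `(Φ t)`, `t ∈ [0,1]`, is an isotopy of `ℂⁿ` starting at the identity and fixing the origin:
a continuous family of homeomorphisms with continuous family of inverses, which in addition is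
`C^∞` in `(t, z)`, together with the family of inverses, for `z` outside `S`.
With `S = ∅` this is a smooth isotopy; with `S = {0}` it is a topological isotopy that restricts
to a smooth isotopy of `ℂⁿ ∖ {0}`. -/
def IsIsotopy {n : ℕ} (S : Set (Cn n)) (Φ : ℝ → Cn n → Cn n) : Prop :=
  (∀ z, Φ 0 z = z) ∧
  (∀ t ∈ Set.Icc (0 : ℝ) 1, Φ t 0 = 0) ∧
  ∃ Ψ : ℝ → Cn n → Cn n,
    (∀ t ∈ Set.Icc (0 : ℝ) 1,
      Function.LeftInverse (Ψ t) (Φ t) ∧ Function.RightInverse (Ψ t) (Φ t)) ∧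
    ContinuousOn (fun p : ℝ × Cn n => Φ p.1 p.2) (Set.Icc (0 : ℝ) 1 ×ˢ Set.univ) ∧
    ContinuousOn (fun p : ℝ × Cn n => Ψ p.1 p.2) (Set.Icc (0 : ℝ) 1 ×ˢ Set.univ) ∧
    ContDiffOn ℝ ∞ (fun p : ℝ × Cn n => Φ p.1 p.2) (Set.Icc (0 : ℝ) 1 ×ˢ Sᶜ) ∧
    ContDiffOn ℝ ∞ (fun p : ℝ × Cn n => Ψ p.1 p.2) (Set.Icc (0 : ℝ) 1 ×ˢ Sᶜ)

/-- The quadratic form `Q(z) = |z₁|² + ⋯ + |zₙ|²`. -/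
noncomputable def Q {n : ℕ} (z : Cn n) : ℝ := ∑ i, ‖z i‖ ^ 2

/-- The Hessian of a real function on a real normed space, as a bilinear form. -/
noncomputable def hessian {V : Type*} [NormedAddCommGroup V] [NormedSpace ℝ V]
    (g : V → ℝ) (x : V) : V →L[ℝ] V →L[ℝ] ℝ :=
  fderiv ℝ (fderiv ℝ g) x

/-- `g` is a (real analytic) Morse function on `ℂⁿ` whose only critical point is the origin,
where it is non-degenerate of Morse index `0`. -/
def IsMorseIndexZero {n : ℕ} (g : Cn n → ℝ) : Prop :=
  AnalyticOnNhd ℝ g Set.univ ∧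
  (∀ z, fderiv ℝ g z = 0 ↔ z = 0) ∧
  ∀ v, v ≠ 0 → 0 < hessian g 0 v v

/-- `g` is smoothly isotopic to the quadratic form `Q`. -/
def IsotopicToQ {n : ℕ} (g : Cn n → ℝ) : Prop :=
  ∃ Ψ : ℝ → Cn n → Cn n, IsIsotopy ∅ Ψ ∧ ∀ z, g z = Q (Ψ 1 z)

/-- `φ` is a smooth local parametrization, centred at `z`, of the leaf through `z` of the
foliation with first integral `f` (the leaves have real dimension `2 (n - 1)`). -/
def IsLeafChart {n : ℕ} (f : Cn n → ℂ) (z : Cn n)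
    (φ : EuclideanSpace ℝ (Fin (2 * (n - 1))) → Cn n) : Prop :=
  φ 0 = z ∧ ContDiffAt ℝ ∞ φ 0 ∧ Function.Injective (fderiv ℝ φ 0) ∧
  ∀ᶠ u in nhds 0, f (φ u) = f z

/-- `z` is a critical point of the restriction of `g` to its leaf: the differential of `g`
vanishes on the tangent space `ker df(z)` of the leaf. -/
def IsContact {n : ℕ} (f : Cn n → ℂ) (g : Cn n → ℝ) (z : Cn n) : Prop :=
  ∀ v, fderiv ℂ f z v = 0 → fderiv ℝ g z v = 0

/-- The Hessian at `z` of the restriction of `g` to its leaf is non-degenerate. -/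
def IsNondegenerateOnLeaf {n : ℕ} (f : Cn n → ℂ) (g : Cn n → ℝ) (z : Cn n) : Prop :=
  ∀ φ, IsLeafChart f z φ → ∀ u, (∀ v, hessian (g ∘ φ) 0 u v = 0) → u = 0

/-- The restriction of `g` to the leaf `L` is a Morse function: its critical values are isolated
and its critical points are non-degenerate. -/
def IsMorseOnLeaf {n : ℕ} (f : Cn n → ℂ) (g : Cn n → ℝ) (L : Set (Cn n)) : Prop :=
  (∀ z ∈ L, IsContact f g z → ∃ ε > 0, ∀ w ∈ L, IsContact f g w →
    |g w - g z| < ε → g w = g z) ∧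
  ∀ z ∈ L, IsContact f g z → IsNondegenerateOnLeaf f g z

/-- The foliation with first integral `f` has a Morse structure compatible with `g`: the function
`g` is smooth away from the origin and restricts to a Morse function on each leaf. -/
def CarriesMorseStructure {n : ℕ} (f : Cn n → ℂ) (g : Cn n → ℝ) : Prop :=
  ContDiffOn ℝ ∞ g {0}ᶜ ∧ ∀ L ∈ foliation f, IsMorseOnLeaf f g L

end HolFol

/-! ### Pencils of forms: finitely many members have a nontrivial common zero. -/

namespace HolFol
open MvPolynomial

/-! For (1), join `h` to the Fermat polynomial by the complex pencil `p + s (q - p)`. A member has a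
critical point off the origin for only finitely many `s` (`finite_setOf_exists_common_zero`): by the
Nullstellensatz the partial derivatives of `p` generate all forms of large degree, and an
exceptional `s ≠ 0` yields an eigenvalue `-s⁻¹` of an endomorphism of a finite-dimensional space of
forms. The remaining parameters form a connected set, so it is enough to relate nearby members.
There `f s (z + p z) = f s₀ z` is solved near the unit sphere by moving along the gradient of `f
s₀`, and the solution is extended by homogeneity (`eventually_exists_perturbation`). The
displacement is `1 / 2`-Lipschitz, so `z + t • p z` is an isotopy; these isotopies are composed and
inverted along the connected set (`exists_isIsotopy_of_countable`). The final map intertwines the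
first integrals, hence carries leaves to leaves and pulls Morse structures back.

Critical points of `Q ∘ B` on leaves, with `B` linear and invertible, are studied by Lagrange
multipliers. There are none on the zero level, where the radial vector is tangent to the leaf.
Elsewhere, nondegeneracy on the leaf follows from a second order condition, `LagrangeNondegenerate`,
which also makes the contacts on one level isolated; since `Q ∘ B` is proper, the critical values
are isolated (`carriesMorseStructure_of_lagrangeNondegenerate`). For the Fermat polynomial and `B =
1` the condition is a computation using `k > 2` (`lagrangeNondegenerate_fermat`), which completes
(1).

For (2), `B` is a generic linear map near the identity. Lagrange's equations on the level `1` are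
transverse in the point, the multiplier and `B` jointly, so Sard's theorem gives a dense set of good
`B` (`exists_lagrangeNondegenerate`); complex homothety reduces every nonzero level to the level
`1`. The segment from the identity to `B` is the isotopy from `Q` to `Q ∘ B`. -/

/-- The linear map `a ↦ ∑ j, a j * p j` on tuples of homogeneous polynomials. -/
noncomputable def sumMul {n e : ℕ} (N : ℕ) (p : Fin n → MvPolynomial (Fin n) ℂ)
    (hp : ∀ j, (p j).IsHomogeneous e) :
    (Fin n → homogeneousSubmodule (Fin n) ℂ N) →ₗ[ℂ] homogeneousSubmodule (Fin n) ℂ (N + e) :=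
  LinearMap.codRestrict _
    (∑ j, LinearMap.mulRight ℂ (p j) ∘ₗ Submodule.subtype _ ∘ₗ LinearMap.proj j) (by
      intro a
      rw [LinearMap.sum_apply]
      exact Submodule.sum_mem _ fun j _ => IsHomogeneous.mul (a j).2 (hp j))

lemma coe_sumMul {n e : ℕ} (N : ℕ) (p : Fin n → MvPolynomial (Fin n) ℂ)
    (hp : ∀ j, (p j).IsHomogeneous e) (a : Fin n → homogeneousSubmodule (Fin n) ℂ N) :
    (sumMul N p hp a : MvPolynomial (Fin n) ℂ) = ∑ j, (a j : MvPolynomial (Fin n) ℂ) * p j := by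
  simp [sumMul]

lemma homogeneousComponent_mul_of_isHomogeneous {n e N : ℕ} (a p : MvPolynomial (Fin n) ℂ)
    (hp : p.IsHomogeneous e) :
    homogeneousComponent (N + e) (a * p) = homogeneousComponent N a * p := by
  let _ := MvPolynomial.gradedAlgebra (σ := Fin n) (R := ℂ)
  have h1 := DirectSum.coe_decompose_mul_of_right_mem_of_le
    (homogeneousSubmodule (Fin n) ℂ) (a := a) (n := N + e) (i := e) hp (by omega)
  have h2 (φ : MvPolynomial (Fin n) ℂ) (i : ℕ) :
      (DirectSum.decompose (homogeneousSubmodule (Fin n) ℂ) φ i : MvPolynomial (Fin n) ℂ)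
        = homogeneousComponent i φ := decomposition.decompose'_apply φ i
  rw [h2, h2] at h1
  simpa using h1

/-- If the forms `q j` have no common zero but the origin, then every form of large degree is a
combination of the `q j`. -/
lemma exists_surjective_sumMul {n e : ℕ} (q : Fin n → MvPolynomial (Fin n) ℂ)
    (hq : ∀ j, (q j).IsHomogeneous e)
    (h0 : ∀ z : Fin n → ℂ, (∀ j, eval z (q j) = 0) → z = 0) :
    ∃ N, Function.Surjective (sumMul N q hq) := by
  set I := Ideal.span (Set.range q) with hI
  -- Nullstellensatz: every variable vanishes at the only possible zero of `I`, the origin.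
  have hrad : idealOfVars (Fin n) ℂ ≤ I.radical := by
    rw [← vanishingIdeal_zeroLocus_eq_radical (K := ℂ) I, idealOfVars, Ideal.span_le]
    rintro _ ⟨i, rfl⟩
    rw [SetLike.mem_coe, mem_vanishingIdeal_iff]
    intro z hz
    have : z = 0 := h0 z fun j => by
      have := mem_zeroLocus_iff.1 hz (q j) (Ideal.subset_span ⟨j, rfl⟩)
      simpa [aeval_eq_eval] using this
    simp [this]
  obtain ⟨N, hN⟩ := Ideal.exists_pow_le_of_le_radical_of_fg hrad (idealOfVars_fg (Fin n) ℂ)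
  refine ⟨N, fun b => ?_⟩
  have hb : (b : MvPolynomial (Fin n) ℂ) ∈ I := by
    apply hN
    rw [mem_pow_idealOfVars_iff]
    intro d hd
    have := IsHomogeneous.degree_eq_sum_deg_support b.2 hd
    rw [Finsupp.degree_apply]
    omega
  obtain ⟨c, hc⟩ := (Ideal.mem_span_range_iff_exists_fun).1 hb
  -- As `b` and the `q j` are homogeneous, only the degree `N` parts of the coefficients contribute.
  refine ⟨fun j => ⟨homogeneousComponent N (c j), homogeneousComponent_mem _ _⟩, ?_⟩
  apply Subtype.ext
  rw [coe_sumMul]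
  calc ∑ j, homogeneousComponent N (c j) * q j
      = ∑ j, homogeneousComponent (N + e) (c j * q j) :=
        Finset.sum_congr rfl fun j _ => (homogeneousComponent_mul_of_isHomogeneous _ _ (hq j)).symm
    _ = homogeneousComponent (N + e) (b : MvPolynomial (Fin n) ℂ) := by rw [← map_sum, hc]
    _ = b := homogeneousComponent_eq_self b.2

/-- In a pencil of tuples of forms whose member at `0` has no common zero but the origin, only
finitely many members have one. -/
theorem finite_setOf_exists_common_zero {n e : ℕ} (q r : Fin n → MvPolynomial (Fin n) ℂ)
    (hq : ∀ j, (q j).IsHomogeneous e) (hr : ∀ j, (r j).IsHomogeneous e)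
    (h0 : ∀ z : Fin n → ℂ, (∀ j, eval z (q j) = 0) → z = 0) :
    {s : ℂ | ∃ z ≠ 0, ∀ j, eval z (q j) + s * eval z (r j) = 0}.Finite := by
  obtain ⟨N, hN⟩ := exists_surjective_sumMul q hq h0
  obtain ⟨R, hR⟩ := (sumMul N q hq).exists_rightInverse_of_surjective (LinearMap.range_eq_top.2 hN)
  have : Module.Finite ℂ (homogeneousSubmodule (Fin n) ℂ (N + e)) :=
    Module.Finite.iff_fg.2 (homogeneousSubmodule_fg _ _ _)
  -- `L` rewrites a form as a combination of the `q j` and replaces each `q j` by `r j`. At a common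
  -- zero of the member `s` one has `q j = -s * r j`, so evaluation there satisfies `ev = -s * ev ∘
  -- L`.
  set L : Module.End ℂ (homogeneousSubmodule (Fin n) ℂ (N + e)) := sumMul N r hr ∘ₗ R with hL
  refine (L.finite_hasEigenvalue.image fun μ => -μ⁻¹).subset ?_
  rintro s ⟨z, hz, hs⟩
  set ev : homogeneousSubmodule (Fin n) ℂ (N + e) →ₗ[ℂ] ℂ :=
    (aeval z).toLinearMap ∘ₗ Submodule.subtype _ with hev
  have ev_apply (b) : ev b = eval z (b : MvPolynomial (Fin n) ℂ) := by simp [hev, aeval_eq_eval]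
  have key (b) : ev b = -s * ev (L b) := by
    have hb : sumMul N q hq (R b) = b := LinearMap.congr_fun hR b
    conv_lhs => rw [← hb]
    rw [ev_apply, ev_apply, hL, LinearMap.comp_apply, coe_sumMul, coe_sumMul, map_sum, map_sum,
      Finset.mul_sum]
    refine Finset.sum_congr rfl fun j _ => ?_
    rw [map_mul, map_mul]
    linear_combination (eval z (R b j : MvPolynomial (Fin n) ℂ)) * hs j
  obtain ⟨i, hi⟩ : ∃ i, z i ≠ 0 := by
    by_contra! hcon
    exact hz (funext hcon)
  set b₀ : homogeneousSubmodule (Fin n) ℂ (N + e) := ⟨X i ^ (N + e), isHomogeneous_X_pow i _⟩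
  have hb₀ : ev b₀ ≠ 0 := by
    rw [ev_apply]
    simpa [b₀] using fun h => absurd h hi
  have hs0 : s ≠ 0 := by
    rintro rfl
    apply hb₀
    rw [key]
    simp
  refine ⟨-s⁻¹, ?_, by simp⟩
  rw [Set.mem_ofPred_eq, Module.End.hasEigenvalue_iff_mem_spectrum, spectrum.mem_iff]
  intro hu
  -- By `key`, `ev` kills the range of `-s⁻¹ - L`, but it does not kill `b₀`.
  obtain ⟨b, hb⟩ := ((Module.End.isUnit_iff _).1 hu).2 b₀
  apply hb₀
  rw [← hb, LinearMap.sub_apply, map_sub, Module.algebraMap_end_apply, map_smul, smul_eq_mul,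
    key b]
  field_simp
  ring

end HolFol

/-! ### Isotopies from Lipschitz perturbations of the identity. -/

namespace HolFol
open Set Filter Topology

lemma exists_continuousLinearEquiv_of_injective {E F : Type*} [NormedAddCommGroup E]
    [NormedSpace ℝ E] [FiniteDimensional ℝ E] [NormedAddCommGroup F] [NormedSpace ℝ F]
    [FiniteDimensional ℝ F] (A : E →L[ℝ] F) (hA : Function.Injective A)
    (hd : Module.finrank ℝ E = Module.finrank ℝ F) : ∃ e : E ≃L[ℝ] F, (e : E →L[ℝ] F) = A := by
  refine ⟨(LinearMap.linearEquivOfInjective A.toLinearMap hA hd).toContinuousLinearEquiv, ?_⟩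
  ext x
  rfl

/-- A left inverse, on an open set, of a smooth map with invertible differentials is smooth on the
image of that set, which is open. -/
lemma contDiffOn_image_of_leftInverse {E F : Type*} [NormedAddCommGroup E] [NormedSpace ℝ E]
    [FiniteDimensional ℝ E] [NormedAddCommGroup F] [NormedSpace ℝ F] [FiniteDimensional ℝ F]
    (hd : Module.finrank ℝ E = Module.finrank ℝ F) {T : E → F} {G : F → E} {N : Set E}
    (hN : IsOpen N) (hT : ContDiffOn ℝ ∞ T N)
    (hinj : ∀ x ∈ N, Function.Injective (fderiv ℝ T x)) (hG : ∀ x ∈ N, G (T x) = x) :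
    IsOpen (T '' N) ∧ ContDiffOn ℝ ∞ G (T '' N) := by
  have : CompleteSpace E := FiniteDimensional.complete ℝ E
  have key : ∀ x ∈ N, T '' N ∈ 𝓝 (T x) ∧ ContDiffAt ℝ ∞ G (T x) := by
    intro x hx
    have hTx : ContDiffAt ℝ ∞ T x := hT.contDiffAt (hN.mem_nhds hx)
    obtain ⟨e, he⟩ := exists_continuousLinearEquiv_of_injective _ (hinj x hx) hd
    have hder : HasFDerivAt T (e : E →L[ℝ] F) x := by
      rw [he]
      exact (hTx.differentiableAt (by simp)).hasFDerivAt
    set P := hTx.toOpenPartialHomeomorph T hder (by simp) with hP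
    have hPT : ∀ y, P y = T y := fun y => rfl
    have hxs : x ∈ P.source := hTx.mem_toOpenPartialHomeomorph_source hder (by simp)
    have hyt : T x ∈ P.target := P.map_source hxs
    have hsymm : P.symm (T x) = x := P.left_inv hxs
    have hev : ∀ᶠ y in 𝓝 (T x), P.symm y ∈ N ∧ T (P.symm y) = y := by
      have h1 : ∀ᶠ y in 𝓝 (T x), P.symm y ∈ N := by
        apply (P.continuousAt_symm hyt).eventually
        rw [hsymm]
        exact hN.mem_nhds hx
      filter_upwards [h1, P.open_target.mem_nhds hyt] with y h2 h3
      exact ⟨h2, P.right_inv h3⟩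
    refine ⟨?_, ?_⟩
    · filter_upwards [hev] with y hy
      exact ⟨_, hy.1, hy.2⟩
    · have h4 : ContDiffAt ℝ ∞ P.symm (T x) := hTx.to_localInverse hder (by simp)
      refine h4.congr_of_eventuallyEq ?_
      filter_upwards [hev] with y hy
      conv_lhs => rw [← hy.2]
      exact hG _ hy.1
  refine ⟨isOpen_iff_mem_nhds.2 ?_, ?_⟩
  · rintro _ ⟨x, hx, rfl⟩
    exact (key x hx).1
  · rintro _ ⟨x, hx, rfl⟩
    exact (key x hx).2.contDiffWithinAt

section Perturbation

variable {E : Type*} [NormedAddCommGroup E] [NormedSpace ℝ E] {p : E → E} {t : ℝ}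

/-- The case `s = t` gives injectivity; distinct parameters give joint continuity of the inverse in
time and space. -/
lemma norm_sub_le_of_perturbation (hp : LipschitzWith (1 / 2) p) (s t : ℝ) (x y : E) :
    (1 - |t| / 2) * ‖x - y‖ ≤ ‖(x + t • p x) - (y + s • p y)‖ + |t - s| * ‖p y‖ := by
  have h1 : x - y = ((x + t • p x) - (y + s • p y)) - t • (p x - p y) - (t - s) • p y := by
    module
  have h2 : ‖p x - p y‖ ≤ 1 / 2 * ‖x - y‖ := by
    simpa using hp.norm_sub_le x y
  have h3 : ‖x - y‖ ≤ ‖(x + t • p x) - (y + s • p y)‖ + |t| * ‖p x - p y‖ + |t - s| * ‖p y‖ := by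
    conv_lhs => rw [h1]
    refine (norm_sub_le _ _).trans ?_
    rw [norm_smul, Real.norm_eq_abs]
    gcongr
    refine (norm_sub_le _ _).trans ?_
    rw [norm_smul, Real.norm_eq_abs]
  nlinarith [abs_nonneg t]

lemma bijective_perturbation [CompleteSpace E] (hp : LipschitzWith (1 / 2) p) (ht : |t| < 2) :
    Function.Bijective fun z => z + t • p z := by
  constructor
  · intro x y hxy
    have h := norm_sub_le_of_perturbation hp t t x y
    simp only at hxy
    rw [hxy] at h
    simp only [sub_self, norm_zero, abs_zero, zero_mul, add_zero] at h
    have : ‖x - y‖ ≤ 0 := by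
      by_contra! hpos
      nlinarith
    simpa [sub_eq_zero] using this
  · intro w
    -- A preimage of `w` is a fixed point of this contraction.
    have hc : ContractingWith (Real.toNNReal (|t| / 2)) fun z => w - t • p z := by
      refine ⟨?_, LipschitzWith.of_dist_le_mul fun x y => ?_⟩
      · rw [← NNReal.coe_lt_coe, Real.coe_toNNReal _ (by positivity)]
        simp only [NNReal.coe_one]
        linarith
      · rw [Real.coe_toNNReal _ (by positivity), dist_eq_norm, dist_eq_norm,
          show w - t • p x - (w - t • p y) = -(t • (p x - p y)) by module, norm_neg, norm_smul,
          Real.norm_eq_abs]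
        have h2 : ‖p x - p y‖ ≤ 1 / 2 * ‖x - y‖ := by
          simpa using hp.norm_sub_le x y
        nlinarith [abs_nonneg t]
    have : Nonempty E := ⟨w⟩
    refine ⟨hc.fixedPoint, ?_⟩
    have := hc.fixedPoint_isFixedPt
    rw [Function.IsFixedPt] at this
    calc hc.fixedPoint + t • p hc.fixedPoint
        = (w - t • p hc.fixedPoint) + t • p hc.fixedPoint := by rw [this]
      _ = w := by module

end Perturbation

/-- A perturbation of the identity with Lipschitz constant at most `1 / 2` defines an isotopy. -/
theorem isIsotopy_perturbation {n : ℕ} {S : Set (Cn n)} (hS : IsClosed S) {p : Cn n → Cn n}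
    (hp : LipschitzWith (1 / 2) p) (hp0 : p 0 = 0) (hps : ContDiffOn ℝ ∞ p Sᶜ)
    (hpS : ∀ t : ℝ, |t| < 2 → ∀ z, z + t • p z ∈ S ↔ z ∈ S) :
    IsIsotopy S fun t z => z + t • p z := by
  have hIcc : ∀ t ∈ Icc (0 : ℝ) 1, |t| < 2 := fun t ht => by
    rw [abs_of_nonneg ht.1]; linarith [ht.2]
  have hbij : ∀ t : ℝ, |t| < 2 → ∃ ψ : Cn n → Cn n,
      Function.LeftInverse ψ (fun z => z + t • p z) ∧
      Function.RightInverse ψ (fun z => z + t • p z) := fun t ht =>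
    Function.bijective_iff_has_inverse.1 (bijective_perturbation hp ht)
  choose! Ψ hΨl hΨr using hbij
  have hTsmooth : ContDiffOn ℝ ∞ (fun x : ℝ × Cn n => x.2 + x.1 • p x.2) (univ ×ˢ Sᶜ) := by
    have h1 : ContDiffOn ℝ ∞ (fun x : ℝ × Cn n => p x.2) (univ ×ˢ Sᶜ) :=
      hps.comp contDiff_snd.contDiffOn fun x hx => hx.2
    exact contDiff_snd.contDiffOn.add (contDiff_fst.contDiffOn.smul h1)
  refine ⟨by simp, by simp [hp0], Ψ, fun t ht => ⟨hΨl t (hIcc t ht), hΨr t (hIcc t ht)⟩,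
    ?_, ?_, ?_, ?_⟩
  · have := hp.continuous
    fun_prop
  · rintro ⟨s, w⟩ ⟨hs, -⟩
    rw [ContinuousWithinAt, tendsto_iff_norm_sub_tendsto_zero]
    set y := Ψ s w with hy
    have hyw : y + s • p y = w := hΨr s (hIcc s hs) w
    -- The factor `2` comes from `1 - |t| / 2 ≥ 1 / 2` on `[0, 1]`.
    have hlim : Tendsto (fun q : ℝ × Cn n => 2 * (‖q.2 - w‖ + |q.1 - s| * ‖p y‖))
        (𝓝[Icc (0 : ℝ) 1 ×ˢ univ] (s, w)) (𝓝 0) := by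
      have : Continuous fun q : ℝ × Cn n => 2 * (‖q.2 - w‖ + |q.1 - s| * ‖p y‖) := by fun_prop
      have h := this.tendsto (s, w)
      simp only [sub_self, norm_zero, abs_zero, zero_mul, add_zero, mul_zero] at h
      exact h.mono_left nhdsWithin_le_nhds
    refine squeeze_zero' (Eventually.of_forall fun _ => norm_nonneg _) ?_ hlim
    filter_upwards [self_mem_nhdsWithin] with q hq
    have hq1 := hIcc q.1 hq.1
    have h := norm_sub_le_of_perturbation hp s q.1 (Ψ q.1 q.2) y
    rw [hyw, show Ψ q.1 q.2 + q.1 • p (Ψ q.1 q.2) = q.2 from hΨr q.1 hq1 q.2] at h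
    have h5 : |q.1| ≤ 1 := by rw [abs_of_nonneg hq.1.1]; exact hq.1.2
    nlinarith [norm_nonneg (Ψ q.1 q.2 - y)]
  · exact hTsmooth.mono (prod_mono (subset_univ _) subset_rfl)
  · set T : ℝ × Cn n → ℝ × Cn n := fun x => (x.1, x.2 + x.1 • p x.2) with hT
    -- The estimates hold for `|t| < 2`, so the inverse function theorem applies on an open set of
    -- times containing `[0, 1]`, endpoints included.
    set N : Set (ℝ × Cn n) := Ioo (-2) 2 ×ˢ Sᶜ with hNdef
    have hN : IsOpen N := isOpen_Ioo.prod hS.isOpen_compl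
    have hTN : ContDiffOn ℝ ∞ T N :=
      contDiff_fst.contDiffOn.prodMk (hTsmooth.mono (prod_mono (subset_univ _) subset_rfl))
    have hinj : ∀ x ∈ N, Function.Injective (fderiv ℝ T x) := by
      rintro ⟨t, z⟩ ⟨ht, hz⟩
      have hpd : HasFDerivAt p (fderiv ℝ p z) z :=
        ((hps.contDiffAt (hS.isOpen_compl.mem_nhds hz)).differentiableAt (by simp)).hasFDerivAt
      have h2 : HasFDerivAt (fun x : ℝ × Cn n => p x.2)
          ((fderiv ℝ p z).comp (ContinuousLinearMap.snd ℝ ℝ (Cn n))) (t, z) :=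
        HasFDerivAt.comp (t, z) (f := Prod.snd) hpd hasFDerivAt_snd
      have h1 := (hasFDerivAt_fst (𝕜 := ℝ) (p := (t, z))).prodMk
        ((hasFDerivAt_snd (𝕜 := ℝ) (p := (t, z))).add
          ((hasFDerivAt_fst (𝕜 := ℝ) (p := (t, z))).smul h2))
      have h3 : fderiv ℝ T (t, z) = _ := h1.fderiv
      rw [h3, injective_iff_map_eq_zero]
      rintro ⟨τ, ζ⟩ h0
      simp only [ContinuousLinearMap.prod_apply, ContinuousLinearMap.coe_fst',
        add_apply, ContinuousLinearMap.coe_snd',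
        smul_apply, ContinuousLinearMap.comp_apply,
        ContinuousLinearMap.smulRight_apply, Prod.mk_eq_zero] at h0
      obtain ⟨rfl, h4⟩ := h0
      simp only [zero_smul, add_zero] at h4
      have h5 : ‖fderiv ℝ p z‖ ≤ 1 / 2 := by simpa using norm_fderiv_le_of_lipschitz ℝ hp
      have h6 : ‖ζ‖ ≤ |t| * (1 / 2 * ‖ζ‖) := by
        have h8 : ‖ζ‖ = |t| * ‖fderiv ℝ p z ζ‖ := by
          rw [← Real.norm_eq_abs, ← norm_smul, ← norm_neg (t • _), ← eq_neg_of_add_eq_zero_left h4]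
        rw [h8]
        gcongr
        rw [← h8]
        exact (fderiv ℝ p z).le_of_opNorm_le h5 ζ
      have h7 : |t| < 2 := abs_lt.2 ht
      have : ‖ζ‖ ≤ 0 := by
        by_contra! hpos
        nlinarith
      simpa using this
    have h := (contDiffOn_image_of_leftInverse rfl hN hTN hinj
      (G := fun x => (x.1, Ψ x.1 x.2)) ?_).2
    · refine ContDiffOn.mono (h.snd) ?_
      rintro ⟨t, w⟩ ⟨ht, hw⟩
      have ht2 := hIcc t ht
      refine ⟨(t, Ψ t w), ⟨abs_lt.1 ht2, ?_⟩, ?_⟩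
      · intro hmem
        apply hw
        have := (hpS t ht2 (Ψ t w)).2 hmem
        rwa [show Ψ t w + t • p (Ψ t w) = w from hΨr t ht2 w] at this
      · simp only [hT]
        rw [show Ψ t w + t • p (Ψ t w) = w from hΨr t ht2 w]
    · rintro ⟨t, z⟩ ⟨ht, hz⟩
      simp only [hT]
      rw [show Ψ t (z + t • p z) = z from hΨl t (abs_lt.2 ht) z]

end HolFol

/-! ### Hermitian gradients and displacements near the unit sphere. -/

namespace HolFol
open Set Filter Topology

/-- The isometry from covectors to vectors given by the Hermitian product, as a real-linear map. -/
noncomputable def rieszReal (n : ℕ) : (Cn n →L[ℂ] ℂ) →L[ℝ] Cn n :=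
  AddMonoidHom.toRealLinearMap
    ((InnerProductSpace.toDual ℂ (Cn n)).symm : (Cn n →L[ℂ] ℂ) →+ Cn n)
    (InnerProductSpace.toDual ℂ (Cn n)).symm.continuous

lemma rieszReal_apply {n : ℕ} (l : Cn n →L[ℂ] ℂ) :
    rieszReal n l = (InnerProductSpace.toDual ℂ (Cn n)).symm l := rfl

lemma inner_rieszReal {n : ℕ} (l : Cn n →L[ℂ] ℂ) (v : Cn n) :
    inner ℂ (rieszReal n l) v = l v := by
  rw [rieszReal_apply, InnerProductSpace.toDual_symm_apply]

lemma rieszReal_smul {n : ℕ} (c : ℂ) (l : Cn n →L[ℂ] ℂ) :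
    rieszReal n (c • l) = (starRingEnd ℂ) c • rieszReal n l := by
  rw [rieszReal_apply, rieszReal_apply, map_smulₛₗ]

lemma rieszReal_eq_zero {n : ℕ} {l : Cn n →L[ℂ] ℂ} : rieszReal n l = 0 ↔ l = 0 := by
  rw [rieszReal_apply, LinearIsometryEquiv.map_eq_zero_iff]

/-- The Hermitian gradient of a holomorphic function. -/
noncomputable def grad {n : ℕ} (f : Cn n → ℂ) (z : Cn n) : Cn n :=
  rieszReal n (fderiv ℂ f z)

lemma inner_grad {n : ℕ} (f : Cn n → ℂ) (z v : Cn n) :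
    inner ℂ (grad f z) v = fderiv ℂ f z v := inner_rieszReal _ _

lemma contDiff_grad {n : ℕ} {f : Cn n → ℂ} (hf : ContDiff ℂ ∞ f) : ContDiff ℝ ∞ (grad f) :=
  (rieszReal n).contDiff.comp
    ((hf.fderiv_right (m := ∞) (by simp)).restrict_scalars ℝ)

/-- A positively homogeneous map whose size and differential are at most `c` on the unit sphere is
`c`-Lipschitz. -/
lemma lipschitzWith_of_homogeneous {E : Type*} [NormedAddCommGroup E] [NormedSpace ℝ E]
    {p : E → E} {c : NNReal} (hp0 : p 0 = 0) (hhom : ∀ r : ℝ, 0 < r → ∀ z, p (r • z) = r • p z)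
    (hd : ∀ z, z ≠ 0 → DifferentiableAt ℝ p z) (hb : ∀ u, ‖u‖ = 1 → ‖p u‖ ≤ c)
    (hb' : ∀ u, ‖u‖ = 1 → ‖fderiv ℝ p u‖ ≤ c) : LipschitzWith c p := by
  have hunit : ∀ z : E, z ≠ 0 → ‖‖z‖⁻¹ • z‖ = 1 := fun z hz => by
    rw [norm_smul, norm_inv, norm_norm, inv_mul_cancel₀ (norm_ne_zero_iff.2 hz)]
  have hscale : ∀ z : E, z ≠ 0 → ‖z‖ • ‖z‖⁻¹ • z = z := fun z hz => by
    rw [smul_smul, mul_inv_cancel₀ (norm_ne_zero_iff.2 hz), one_smul]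
  have hsize : ∀ z, ‖p z‖ ≤ c * ‖z‖ := by
    intro z
    rcases eq_or_ne z 0 with rfl | hz
    · simp [hp0]
    · rw [← hscale z hz, hhom _ (norm_pos_iff.2 hz), norm_smul, norm_norm, hscale z hz, mul_comm]
      gcongr
      exact hb _ (hunit z hz)
  have hder : ∀ z, z ≠ 0 → ‖fderiv ℝ p z‖ ≤ c := by
    intro z hz
    have hr : 0 < ‖z‖ := norm_pos_iff.2 hz
    set u := ‖z‖⁻¹ • z with hu
    have hzu : ‖z‖ • u = z := hscale z hz
    have hu0 : u ≠ 0 := by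
      rintro h
      have := hunit z hz
      rw [← hu, h] at this
      simp at this
    have h1 : HasFDerivAt (fun w => p (‖z‖ • w))
        ((fderiv ℝ p z).comp (‖z‖ • ContinuousLinearMap.id ℝ E)) u := by
      have h2 : HasFDerivAt (fun w : E => ‖z‖ • w) (‖z‖ • ContinuousLinearMap.id ℝ E) u :=
        (hasFDerivAt_id u).const_smul ‖z‖
      refine HasFDerivAt.comp u ?_ h2
      rw [hzu]
      exact (hd z hz).hasFDerivAt
    have h3 : HasFDerivAt (fun w => p (‖z‖ • w)) (‖z‖ • fderiv ℝ p u) u := by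
      have : (fun w => p (‖z‖ • w)) = fun w => ‖z‖ • p w := funext fun w => hhom _ hr w
      rw [this]
      exact (hd u hu0).hasFDerivAt.const_smul ‖z‖
    -- The differential of a map homogeneous of degree one is constant along rays.
    have h4 : fderiv ℝ p z = fderiv ℝ p u := by
      have := h1.unique h3
      ext v
      have h5 := congrArg (fun A : E →L[ℝ] E => A v) this
      simp only [ContinuousLinearMap.comp_apply, smul_apply,
        ContinuousLinearMap.id_apply, map_smul] at h5
      exact smul_right_injective E hr.ne' h5
    rw [h4]
    exact hb' u (hunit z hz)
  refine LipschitzWith.of_dist_le_mul fun x y => ?_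
  rw [dist_eq_norm, dist_eq_norm]
  -- The mean value inequality fails on segments through the origin, where `p` may not be
  -- differentiable; there `‖x - y‖ = ‖x‖ + ‖y‖` and the size bound suffices.
  by_cases h0 : (0 : E) ∈ segment ℝ x y
  · have h1 := dist_add_dist_of_mem_segment h0
    rw [dist_zero_right, dist_zero_left, dist_eq_norm] at h1
    calc ‖p x - p y‖ ≤ ‖p x‖ + ‖p y‖ := norm_sub_le _ _
      _ ≤ c * ‖x‖ + c * ‖y‖ := add_le_add (hsize x) (hsize y)
      _ = c * ‖x - y‖ := by rw [← h1]; ring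
  · have hne : ∀ z ∈ segment ℝ x y, z ≠ 0 := fun z hz h => h0 (h ▸ hz)
    exact (convex_segment x y).norm_image_sub_le_of_norm_fderiv_le (fun z hz => hd z (hne z hz))
      (fun z hz => hder z (hne z hz)) (right_mem_segment ℝ x y) (left_mem_segment ℝ x y)

/-- Near the unit sphere, a nearby function in a smooth family is carried to a given holomorphic
function without critical points on the sphere by a small displacement along the gradient. -/
lemma exists_displacement_near_sphere {n : ℕ} {f : ℂ → Cn n → ℂ}
    (hf : ContDiff ℝ ∞ fun x : ℂ × Cn n => f x.1 x.2) {s₀ : ℂ} (hs₀ : ContDiff ℂ ∞ (f s₀))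
    (hcrit : ∀ z, ‖z‖ = 1 → fderiv ℂ (f s₀) z ≠ 0) :
    ∃ (O : Set (ℂ × Cn n)) (π : ℂ × Cn n → Cn n), IsOpen O ∧ ContDiffOn ℝ ∞ π O ∧
      (∀ x ∈ O, f x.1 (x.2 + π x) = f s₀ x.2) ∧
      ∀ z, ‖z‖ = 1 → (s₀, z) ∈ O ∧ ∀ᶠ w in 𝓝 z, π (s₀, w) = 0 := by
  set ν := grad (f s₀) with hν
  have hνs : ContDiff ℝ ∞ ν := contDiff_grad hs₀
  -- `T` trades the coefficient of the displacement along `ν` for the value reached; inverting it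
  -- solves for the displacement.
  set T : ((ℂ × Cn n) × ℂ) → ((ℂ × Cn n) × ℂ) := fun x => (x.1, f x.1.1 (x.1.2 + x.2 • ν x.1.2)) with hT
  have hTs : ContDiff ℝ ∞ T := by
    refine contDiff_fst.prodMk ?_
    have h1 : ContDiff ℝ ∞ fun x : ((ℂ × Cn n) × ℂ) => (x.1.1, x.1.2 + x.2 • ν x.1.2) := by
      refine (contDiff_fst.fst).prodMk (contDiff_fst.snd.add ?_)
      exact contDiff_snd.smul (hνs.comp contDiff_fst.snd)
    exact hf.comp h1
  set C : Set ((ℂ × Cn n) × ℂ) := (fun z => ((s₀, z), (0 : ℂ))) '' Metric.sphere (0 : Cn n) 1 with hC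
  have hCc : IsCompact C := (isCompact_sphere _ _).image (by fun_prop)
  have hTder : ∀ x ∈ C, Function.Injective (fderiv ℝ T x) := by
    rintro _ ⟨z, hz, rfl⟩
    have hz1 : ‖z‖ = 1 := by simpa using hz
    rw [injective_iff_map_eq_zero]
    intro v hv
    have hTd : HasFDerivAt T (fderiv ℝ T ((s₀, z), 0)) ((s₀, z), 0) :=
      (hTs.differentiable (by simp) _).hasFDerivAt
    have h1 : v.1 = 0 := by
      have h2 := hTd.fst.unique (hasFDerivAt_fst (𝕜 := ℝ) (p := (((s₀, z), 0) : ((ℂ × Cn n) × ℂ))))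
      have h3 := congrArg (fun A : ((ℂ × Cn n) × ℂ) →L[ℝ] (ℂ × Cn n) => A v) h2
      have h4 : (0 : (ℂ × Cn n) × ℂ).1 = v.1 := hv ▸ h3
      exact h4.symm
    obtain ⟨⟨σ, ζ⟩, α⟩ := v
    simp only [Prod.mk_eq_zero] at h1
    obtain ⟨rfl, rfl⟩ := h1
    have h4 : HasFDerivAt (fun a : ℂ => ((s₀, z), a)) (ContinuousLinearMap.inr ℝ (ℂ × Cn n) ℂ) 0 :=
      hasFDerivAt_prodMk_right _ _
    have h5 := (HasFDerivAt.comp (0 : ℂ) hTd h4).snd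
    have h6 : HasFDerivAt (𝕜 := ℂ) (fun a : ℂ => z + a • ν z)
        ((ContinuousLinearMap.id ℂ ℂ).smulRight (ν z)) 0 := by
      have := ((hasFDerivAt_id (𝕜 := ℂ) (0 : ℂ)).smul_const (ν z)).const_add z
      exact this
    have h7 : HasFDerivAt (𝕜 := ℂ) (fun a : ℂ => f s₀ (z + a • ν z))
        ((fderiv ℂ (f s₀) z).comp ((ContinuousLinearMap.id ℂ ℂ).smulRight (ν z))) 0 := by
      refine HasFDerivAt.comp (0 : ℂ) ?_ h6
      rw [zero_smul, add_zero]
      exact (hs₀.differentiable (by simp) z).hasFDerivAt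
    have h8 := h5.unique (h7.restrictScalars ℝ)
    have h9 := congrArg (fun A : ℂ →L[ℝ] ℂ => A α) h8
    have hv' : fderiv ℝ T ((s₀, z), 0) ((0, 0), α) = 0 := hv
    -- The derivative of the value in the coefficient is `‖ν z‖ ^ 2`, nonzero on the sphere.
    have h10 : α * inner ℂ (ν z) (ν z) = 0 := by
      have h11 : (fderiv ℝ T ((s₀, z), 0) ((0, 0), α)).2 = fderiv ℂ (f s₀) z (α • ν z) := h9
      rw [inner_grad, ← smul_eq_mul, ← map_smul, ← h11, hv', Prod.snd_zero]
    have hν0 : ν z ≠ 0 := by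
      rw [hν, grad, Ne, rieszReal_eq_zero]
      exact hcrit z hz1
    have : α = 0 := by
      rcases mul_eq_zero.1 h10 with h | h
      · exact h
      · exact absurd (inner_self_eq_zero.1 h) hν0
    rw [this]
    rfl
  have hopen : IsOpen {x : ((ℂ × Cn n) × ℂ) | Function.Injective (fderiv ℝ T x)} := by
    have h1 : {x : ((ℂ × Cn n) × ℂ) | Function.Injective (fderiv ℝ T x)} =
        fderiv ℝ T ⁻¹' (range ((↑) : (((ℂ × Cn n) × ℂ) ≃L[ℝ] ((ℂ × Cn n) × ℂ)) → (((ℂ × Cn n) × ℂ) →L[ℝ] ((ℂ × Cn n) × ℂ)))) := by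
      ext x
      constructor
      · exact fun hx => exists_continuousLinearEquiv_of_injective _ hx rfl
      · rintro ⟨e, he⟩
        change Function.Injective (fderiv ℝ T x)
        rw [← he]
        exact e.injective
    rw [h1]
    exact ContinuousLinearEquiv.isOpen.preimage (hTs.continuous_fderiv (by simp))
  have hTC : InjOn T C := by
    rintro _ ⟨z, hz, rfl⟩ _ ⟨w, hw, rfl⟩ h
    have h1 : (s₀, z) = (s₀, w) := congrArg Prod.fst h
    simp only [h1]
  -- Local injectivity near the compact set `C` and injectivity on `C` give injectivity on a whole
  -- neighbourhood, hence a single inverse around the sphere.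
  obtain ⟨N₀, hN₀, hinj⟩ := hTC.exists_mem_nhdsSet hCc
    (fun x _ => hTs.continuous.continuousAt) (fun x hx => by
      obtain ⟨e, he⟩ := exists_continuousLinearEquiv_of_injective _ (hTder x hx) rfl
      have hst : HasStrictFDerivAt T (e : ((ℂ × Cn n) × ℂ) →L[ℝ] ((ℂ × Cn n) × ℂ)) x := by
        rw [he]
        exact hTs.contDiffAt.hasStrictFDerivAt (by simp)
      exact ⟨_, (hst.toOpenPartialHomeomorph T).open_source.mem_nhds
        hst.mem_toOpenPartialHomeomorph_source, (hst.toOpenPartialHomeomorph T).injOn⟩)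
  obtain ⟨N₁, hN₁, hCN₁, hN₁₀⟩ := mem_nhdsSet_iff_exists.1 hN₀
  set N := N₁ ∩ {x : ((ℂ × Cn n) × ℂ) | Function.Injective (fderiv ℝ T x)} with hN
  have hNo : IsOpen N := hN₁.inter hopen
  have hCN : C ⊆ N := fun x hx => ⟨hCN₁ hx, hTder x hx⟩
  have hTN : InjOn T N := hinj.mono fun x hx => hN₁₀ hx.1
  set G := Function.invFunOn T N with hG
  have hGl : ∀ x ∈ N, G (T x) = x := fun x hx => hTN.leftInvOn_invFunOn hx
  obtain ⟨himo, hGs⟩ := contDiffOn_image_of_leftInverse rfl hNo hTs.contDiffOn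
    (fun x hx => hx.2) hGl
  set ι : ℂ × Cn n → ((ℂ × Cn n) × ℂ) := fun x => (x, f s₀ x.2) with hι
  have hιs : ContDiff ℝ ∞ ι := contDiff_id.prodMk ((hs₀.restrict_scalars ℝ).comp contDiff_snd)
  have hTι : ∀ w, T ((s₀, w), 0) = ι (s₀, w) := fun w => by simp [hT, hι]
  refine ⟨ι ⁻¹' (T '' N), fun x => (G (ι x)).2 • ν x.2, himo.preimage hιs.continuous, ?_, ?_, ?_⟩
  · exact ((hGs.comp hιs.contDiffOn (mapsTo_preimage _ _)).snd).smul (hνs.comp contDiff_snd).contDiffOn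
  · rintro x ⟨y, hy, hyx⟩
    have h1 : G (ι x) = y := by rw [← hyx, hGl y hy]
    have h2 : y.1 = x := congrArg Prod.fst hyx
    have h3 : f y.1.1 (y.1.2 + y.2 • ν y.1.2) = f s₀ x.2 := congrArg Prod.snd hyx
    rw [h2] at h3
    simp only [h1]
    exact h3
  · intro z hz
    have hzN : ((s₀, z), (0 : ℂ)) ∈ N := hCN ⟨z, by simpa using hz, rfl⟩
    refine ⟨⟨_, hzN, hTι z⟩, ?_⟩
    have hcont : Continuous fun w : Cn n => ((s₀, w), (0 : ℂ)) := by fun_prop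
    filter_upwards [hcont.continuousAt.preimage_mem_nhds (hNo.mem_nhds hzN)] with w hw
    rw [← hTι w, hGl _ hw, zero_smul]

end HolFol

/-! ### Local triviality of families, isotopies along connected sets, transport of leaves. -/

namespace HolFol
open Set Filter Topology

/-- In a smooth family of homogeneous functions, the members close to a holomorphic one whose only
critical point is the origin are obtained from it by a small perturbation of the identity. -/
theorem eventually_exists_perturbation {n k : ℕ} (hk : k ≠ 0) {f : ℂ → Cn n → ℂ}
    (hf : ContDiff ℝ ∞ fun x : ℂ × Cn n => f x.1 x.2)
    (hhom : ∀ s (r : ℝ) z, f s (r • z) = (r : ℂ) ^ k * f s z) {s₀ : ℂ}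
    (hs₀ : ContDiff ℂ ∞ (f s₀)) (hcrit : ∀ z, z ≠ 0 → fderiv ℂ (f s₀) z ≠ 0) :
    ∀ᶠ s in 𝓝 s₀, ∃ p : Cn n → Cn n, LipschitzWith (1 / 2) p ∧ p 0 = 0 ∧
      ContDiffOn ℝ ∞ p {0}ᶜ ∧ ∀ z, f s (z + p z) = f s₀ z := by
  obtain ⟨O, π, hO, hπ, hfπ, hOs⟩ := exists_displacement_near_sphere hf hs₀ fun z hz =>
    hcrit z fun h => by simp [h] at hz
  -- Extension by degree one homogeneity in the point, matching the homogeneity of the family.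
  set P : ℂ × Cn n → Cn n := fun x => ‖x.2‖ • π (x.1, ‖x.2‖⁻¹ • x.2) with hP
  have hunit : ∀ z : Cn n, z ≠ 0 → ‖‖z‖⁻¹ • z‖ = 1 := fun z hz => by
    rw [norm_smul, norm_inv, norm_norm, inv_mul_cancel₀ (norm_ne_zero_iff.2 hz)]
  have hPs : ∀ s z, z ≠ 0 → (s, ‖z‖⁻¹ • z) ∈ O → ContDiffAt ℝ ∞ P (s, z) := by
    intro s z hz hmem
    have h1 : ContDiffAt ℝ ∞ (fun x : ℂ × Cn n => ‖x.2‖) (s, z) :=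
      (contDiffAt_norm ℂ hz).comp (s, z) contDiffAt_snd
    have h2 : ContDiffAt ℝ ∞ (fun x : ℂ × Cn n => (x.1, ‖x.2‖⁻¹ • x.2)) (s, z) :=
      contDiffAt_fst.prodMk ((h1.inv (norm_ne_zero_iff.2 hz)).smul contDiffAt_snd)
    exact h1.smul (ContDiffAt.comp (s, z) (g := π) (hπ.contDiffAt (hO.mem_nhds hmem)) h2)
  have hP0 : ∀ z : Cn n, ‖z‖ = 1 → ∀ᶠ w in 𝓝 z, P (s₀, w) = 0 := by
    intro z hz
    have hz0 : z ≠ 0 := fun h => by simp [h] at hz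
    have h1 : ContinuousAt (fun w : Cn n => ‖w‖⁻¹ • w) z :=
      (continuous_norm.continuousAt.inv₀ (norm_ne_zero_iff.2 hz0)).smul continuousAt_id
    have h2 : ‖z‖⁻¹ • z = z := by simp [hz]
    have h3 := h1.eventually (p := fun w => π (s₀, w) = 0) (by beta_reduce; rw [h2]; exact (hOs z hz).2)
    filter_upwards [h3] with w hw
    simp [hP, hw]
  -- At `s₀` the displacement vanishes near the sphere, so it and its derivative in the point are
  -- uniformly small there for nearby `s`, by compactness.
  have hclose : ∀ᶠ s in 𝓝 s₀, ∀ z ∈ Metric.sphere (0 : Cn n) 1,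
      (s, z) ∈ O ∧ ‖P (s, z)‖ ≤ 1 / 2 ∧
        ‖(fderiv ℝ P (s, z)).comp (ContinuousLinearMap.inr ℝ ℂ (Cn n))‖ ≤ 1 / 2 := by
    refine (isCompact_sphere (0 : Cn n) 1).eventually_forall_of_forall_eventually fun z hz => ?_
    have hz1 : ‖z‖ = 1 := by simpa using hz
    have hz0 : z ≠ 0 := fun h => by simp [h] at hz1
    have hzO := (hOs z hz1).1
    have hPz : ContDiffAt ℝ ∞ P (s₀, z) := hPs s₀ z hz0 (by simpa [hz1] using hzO)
    have h0 : P (s₀, z) = 0 := (hP0 z hz1).self_of_nhds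
    have h0' : (fderiv ℝ P (s₀, z)).comp (ContinuousLinearMap.inr ℝ ℂ (Cn n)) = 0 := by
      have h1 : HasFDerivAt (fun w : Cn n => P (s₀, w))
          ((fderiv ℝ P (s₀, z)).comp (ContinuousLinearMap.inr ℝ ℂ (Cn n))) z :=
        HasFDerivAt.comp z (hPz.differentiableAt (by simp)).hasFDerivAt
          (hasFDerivAt_prodMk_right s₀ z)
      exact h1.unique ((hasFDerivAt_const (0 : Cn n) z).congr_of_eventuallyEq (hP0 z hz1))
    have hc1 : ContinuousAt (fun x => ‖P x‖) (s₀, z) := hPz.continuousAt.norm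
    have hc2 : ContinuousAt
        (fun x => ‖(fderiv ℝ P x).comp (ContinuousLinearMap.inr ℝ ℂ (Cn n))‖) (s₀, z) :=
      ((hPz.fderiv_right (m := 0) (by simp)).continuousAt.clm_comp continuousAt_const).norm
    have he1 := hc1.eventually (p := fun r => r < 1 / 2)
      (Iio_mem_nhds (by beta_reduce; rw [h0, norm_zero]; norm_num))
    have he2 := hc2.eventually (p := fun r => r < 1 / 2)
      (Iio_mem_nhds (by beta_reduce; rw [h0', norm_zero]; norm_num))
    filter_upwards [hO.mem_nhds hzO, he1, he2] with x hx1 hx2 hx3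
    exact ⟨hx1, hx2.le, hx3.le⟩
  filter_upwards [hclose] with s hs
  have hs' : ∀ z : Cn n, z ≠ 0 → (s, ‖z‖⁻¹ • z) ∈ O := fun z hz =>
    (hs _ (by simpa using hunit z hz)).1
  have hpd : ∀ z : Cn n, z ≠ 0 → ContDiffAt ℝ ∞ (fun w => P (s, w)) z := fun z hz =>
    (hPs s z hz (hs' z hz)).comp z (contDiffAt_const.prodMk contDiffAt_id)
  refine ⟨fun z => P (s, z), ?_, by simp [hP], fun z hz => (hpd z hz).contDiffWithinAt, ?_⟩
  · refine lipschitzWith_of_homogeneous (by simp [hP]) ?_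
      (fun z hz => (hpd z hz).differentiableAt (by simp)) ?_ ?_
    · intro r hr z
      simp only [hP, norm_smul, Real.norm_eq_abs, abs_of_pos hr, mul_inv]
      rw [mul_smul, show (r⁻¹ * ‖z‖⁻¹) • r • z = ‖z‖⁻¹ • z by
        rw [smul_smul, mul_right_comm, inv_mul_cancel₀ hr.ne', one_mul]]
    · intro u hu
      simpa using (hs u (by simpa using hu)).2.1
    · intro u hu
      have hu0 : u ≠ 0 := fun h => by simp [h] at hu
      have h1 : HasFDerivAt (fun w : Cn n => P (s, w))
          ((fderiv ℝ P (s, u)).comp (ContinuousLinearMap.inr ℝ ℂ (Cn n))) u :=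
        HasFDerivAt.comp u ((hPs s u hu0 (hs' u hu0)).differentiableAt (by simp)).hasFDerivAt
          (hasFDerivAt_prodMk_right s u)
      rw [h1.fderiv]
      simpa using (hs u (by simpa using hu)).2.2
  · intro z
    rcases eq_or_ne z 0 with rfl | hz
    · have h0 : ∀ s, f s 0 = 0 := fun s => by simpa [hk] using hhom s 0 0
      simp [hP, h0]
    · set u := ‖z‖⁻¹ • z with hu
      have hzu : z = ‖z‖ • u := by
        rw [hu, smul_smul, mul_inv_cancel₀ (norm_ne_zero_iff.2 hz), one_smul]
      have h1 : z + P (s, z) = ‖z‖ • (u + π (s, u)) := by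
        rw [smul_add, ← hzu]
      rw [h1, hhom]
      conv_rhs => rw [hzu, hhom]
      rw [hfπ (s, u) (hs' z hz)]

lemma IsIsotopy.exists_symm {n : ℕ} {S : Set (Cn n)} {Φ : ℝ → Cn n → Cn n} (h : IsIsotopy S Φ) :
    ∃ Ψ : ℝ → Cn n → Cn n, IsIsotopy S Ψ ∧ ∀ t ∈ Icc (0 : ℝ) 1,
      Function.LeftInverse (Ψ t) (Φ t) ∧ Function.RightInverse (Ψ t) (Φ t) := by
  obtain ⟨h0, hfix, Ψ, hinv, hc, hc', hs, hs'⟩ := h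
  refine ⟨Ψ, ⟨fun z => ?_, fun t ht => ?_, Φ, fun t ht => ⟨(hinv t ht).2, (hinv t ht).1⟩,
    hc', hc, hs', hs⟩, hinv⟩
  · have := (hinv 0 (by simp)).1 z
    rwa [h0] at this
  · have := (hinv t ht).1 0
    rwa [hfix t ht] at this

lemma IsIsotopy.comp {n : ℕ} {Φ Φ' : ℝ → Cn n → Cn n} (h : IsIsotopy {0} Φ)
    (h' : IsIsotopy {0} Φ') : IsIsotopy {0} fun t z => Φ' t (Φ t z) := by
  obtain ⟨h0, hfix, Ψ, hinv, hc, hcΨ, hs, hsΨ⟩ := h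
  obtain ⟨h0', hfix', Ψ', hinv', hc', hcΨ', hs', hsΨ'⟩ := h'
  have hne : ∀ t ∈ Icc (0 : ℝ) 1, ∀ z, z ≠ 0 → Φ t z ≠ 0 := fun t ht z hz h => hz <|
    (hinv t ht).1.injective (h.trans (hfix t ht).symm)
  have hneΨ : ∀ t ∈ Icc (0 : ℝ) 1, ∀ z, z ≠ 0 → Ψ' t z ≠ 0 := fun t ht z hz h => hz <| by
    rw [← (hinv' t ht).2 z, h, hfix' t ht]
  refine ⟨fun z => by beta_reduce; rw [h0, h0'],
    fun t ht => by beta_reduce; rw [hfix t ht, hfix' t ht],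
    fun t z => Ψ t (Ψ' t z), fun t ht => ⟨?_, ?_⟩, ?_, ?_, ?_, ?_⟩
  · intro z
    simp only [(hinv' t ht).1 _, (hinv t ht).1 _]
  · intro z
    simp only [(hinv t ht).2 _, (hinv' t ht).2 _]
  · exact hc'.comp (continuousOn_fst.prodMk hc) fun x hx => ⟨hx.1, mem_univ _⟩
  · exact hcΨ.comp (continuousOn_fst.prodMk hcΨ') fun x hx => ⟨hx.1, mem_univ _⟩
  · exact hs'.comp (contDiffOn_fst.prodMk hs) fun x hx => ⟨hx.1, hne _ hx.1 _ hx.2⟩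
  · exact hsΨ.comp (contDiffOn_fst.prodMk hsΨ') fun x hx => ⟨hx.1, hneΨ _ hx.1 _ hx.2⟩

/-- In a smooth family of homogeneous holomorphic functions parametrized by the plane, any two of
those whose only critical point is the origin are isotopic, provided that only countably many
members are exceptional. -/
theorem exists_isIsotopy_of_countable {n k : ℕ} (hk : k ≠ 0) {f : ℂ → Cn n → ℂ}
    (hf : ContDiff ℝ ∞ fun x : ℂ × Cn n => f x.1 x.2)
    (hhom : ∀ s (r : ℝ) z, f s (r • z) = (r : ℂ) ^ k * f s z)
    (hhol : ∀ s, ContDiff ℂ ∞ (f s))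
    (hcount : {s | ∃ z, z ≠ 0 ∧ fderiv ℂ (f s) z = 0}.Countable) {s s' : ℂ}
    (hs : ∀ z, z ≠ 0 → fderiv ℂ (f s) z ≠ 0) (hs' : ∀ z, z ≠ 0 → fderiv ℂ (f s') z ≠ 0) :
    ∃ Φ : ℝ → Cn n → Cn n, IsIsotopy {0} Φ ∧ ∀ z, f s' (Φ 1 z) = f s z := by
  set G : Set ℂ := {s | ∃ z, z ≠ 0 ∧ fderiv ℂ (f s) z = 0}ᶜ with hG
  have hGm : ∀ s, s ∈ G ↔ ∀ z, z ≠ 0 → fderiv ℂ (f s) z ≠ 0 := fun s => by simp [hG]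
  have hconn : IsPreconnected G := by
    refine (hcount.isPathConnected_compl_of_one_lt_rank ?_).isConnected.isPreconnected
    rw [Complex.rank_real_complex]
    norm_num
  -- A relation that holds locally, is transitive and is symmetric holds throughout a connected set.
  refine hconn.induction₂ (fun a b => ∃ Φ : ℝ → Cn n → Cn n, IsIsotopy {0} Φ ∧
    ∀ z, f b (Φ 1 z) = f a z) ?_ ?_ ?_ ((hGm s).2 hs) ((hGm s').2 hs')
  · intro a ha
    filter_upwards [mem_nhdsWithin_of_mem_nhds
      (eventually_exists_perturbation hk hf hhom (hhol a) ((hGm a).1 ha))] with b hb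
    obtain ⟨p, hp, hp0, hps, hpf⟩ := hb
    refine ⟨_, isIsotopy_perturbation isClosed_singleton hp hp0 hps ?_, fun z => ?_⟩
    · intro t ht z
      have hinj := (bijective_perturbation hp ht).injective
      constructor
      · exact fun h => hinj (a₁ := z) (a₂ := 0) (by simpa [hp0] using h)
      · rintro rfl
        simp [hp0]
    · rw [one_smul, hpf]
  · rintro a b c - - - ⟨Φ, hΦ, hab⟩ ⟨Φ', hΦ', hbc⟩
    exact ⟨_, hΦ.comp hΦ', fun z => by rw [hbc, hab]⟩
  · rintro a b - - ⟨Φ, hΦ, hab⟩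
    obtain ⟨Ψ, hΨ, hinv⟩ := hΦ.exists_symm
    refine ⟨Ψ, hΨ, fun z => ?_⟩
    rw [← hab, (hinv 1 (by simp)).2]

/-- An isotopy whose final map pulls one first integral back to another carries the leaves of the
second foliation to those of the first. -/
theorem IsIsotopy.carriesFoliation {n : ℕ} {Φ : ℝ → Cn n → Cn n} (h : IsIsotopy {0} Φ)
    {f f' : Cn n → ℂ} (hff' : ∀ z, f' (Φ 1 z) = f z) :
    CarriesFoliation (Φ 1) (foliation f) (foliation f') := by
  obtain ⟨-, hfix, Ψ, hinv, hc, hcΨ, -, -⟩ := h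
  have h1 : (1 : ℝ) ∈ Icc (0 : ℝ) 1 := by simp
  have hcont : Continuous (Φ 1) := continuousOn_univ.1 <|
    hc.comp (f := fun z => ((1 : ℝ), z)) (by fun_prop) fun z _ => ⟨h1, mem_univ _⟩
  have hcontΨ : Continuous (Ψ 1) := continuousOn_univ.1 <|
    hcΨ.comp (f := fun z => ((1 : ℝ), z)) (by fun_prop) fun z _ => ⟨h1, mem_univ _⟩
  let e : Cn n ≃ₜ Cn n :=
    { toFun := Φ 1, invFun := Ψ 1, left_inv := (hinv 1 h1).1, right_inv := (hinv 1 h1).2 }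
  have he0 : ∀ z, Φ 1 z = 0 ↔ z = 0 := fun z =>
    ⟨fun hz => e.injective (hz.trans (hfix 1 h1).symm), fun hz => by rw [hz, hfix 1 h1]⟩
  have hleaf : ∀ z, z ≠ 0 → Φ 1 '' leaf f z = leaf f' (Φ 1 z) := by
    intro z hz
    have h2 := e.image_connectedComponentIn (s := {w | w ≠ 0 ∧ f w = f z}) (x := z) ⟨hz, rfl⟩
    refine h2.trans ?_
    rw [leaf]
    congr 1
    ext w
    constructor
    · rintro ⟨v, ⟨hv0, hv⟩, rfl⟩
      exact ⟨fun h => hv0 ((he0 v).1 h), by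
        change f' (Φ 1 v) = f' (Φ 1 z)
        rw [hff', hff', hv]⟩
    · rintro ⟨hw0, hw⟩
      have hw' : Φ 1 (Ψ 1 w) = w := (hinv 1 h1).2 w
      refine ⟨Ψ 1 w, ⟨fun h => hw0 ?_, ?_⟩, hw'⟩
      · rw [← hw', h, hfix 1 h1]
      · rw [← hff', ← hff', hw', hw]
  ext L
  constructor
  · rintro ⟨_, ⟨z, hz, rfl⟩, rfl⟩
    exact ⟨Φ 1 z, fun h => hz ((he0 z).1 h), hleaf z hz⟩
  · rintro ⟨w, hw, rfl⟩
    have hw' : Φ 1 (Ψ 1 w) = w := (hinv 1 h1).2 w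
    have hz : Ψ 1 w ≠ 0 := fun h => hw (by rw [← hw', h, hfix 1 h1])
    exact ⟨_, ⟨Ψ 1 w, hz, rfl⟩, by simp only [hleaf _ hz, hw']⟩

end HolFol

/-! ### Sard's theorem in equal dimensions and parametric transversality. -/

namespace HolFol
open Set Filter Topology MeasureTheory

/-- The set of critical values of a differentiable map between spaces of the same dimension is
negligible. -/
lemma addHaar_image_eq_zero_of_not_injective {E F : Type*} [NormedAddCommGroup E]
    [NormedSpace ℝ E] [FiniteDimensional ℝ E] [NormedAddCommGroup F] [NormedSpace ℝ F]
    [FiniteDimensional ℝ F] [MeasurableSpace F] [BorelSpace F] (μ : Measure F)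
    [μ.IsAddHaarMeasure] (hd : Module.finrank ℝ E = Module.finrank ℝ F) {f : E → F}
    {f' : E → E →L[ℝ] F} {s : Set E} (hf : ∀ x ∈ s, HasFDerivAt f (f' x) x)
    (hs : ∀ x ∈ s, ¬ Function.Injective (f' x)) : μ (f '' s) = 0 := by
  obtain ⟨e⟩ := FiniteDimensional.nonempty_continuousLinearEquiv_of_finrank_eq hd.symm
  have h1 : f '' s = (f ∘ e) '' (e ⁻¹' s) := by
    rw [image_comp, image_preimage_eq s e.surjective]
  rw [h1]
  refine addHaar_image_eq_zero_of_det_fderivWithin_eq_zero μ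
    (f' := fun y => (f' (e y)).comp (e : F →L[ℝ] E)) (fun y hy => ?_) fun y hy => ?_
  · exact ((hf (e y) hy).comp y e.hasFDerivAt).hasFDerivWithinAt
  · by_contra hdet
    apply hs (e y) hy
    have hinj : Function.Injective ((f' (e y)).comp (e : F →L[ℝ] E)) := by
      have hu : IsUnit (((f' (e y)).comp (e : F →L[ℝ] E) : F →L[ℝ] F) : F →ₗ[ℝ] F) := by
        rw [LinearMap.isUnit_iff_isUnit_det]
        exact isUnit_iff_ne_zero.2 hdet
      exact ((Module.End.isUnit_iff _).1 hu).1
    intro a b hab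
    have h2 := @hinj (e.symm a) (e.symm b) (by simpa using hab)
    exact e.symm.injective h2

/-- Parametric transversality: if `0` is a regular value, along `S`, of a smooth map `F` of a
variable and a parameter, then for a dense set of parameters it is a regular value of the map of
the variable alone. Here the variable and the values have the same number of dimensions. -/
theorem dense_setOf_regular_parameter {Z P T : Type*} [NormedAddCommGroup Z] [NormedSpace ℝ Z]
    [FiniteDimensional ℝ Z] [NormedAddCommGroup P] [NormedSpace ℝ P] [FiniteDimensional ℝ P]
    [NormedAddCommGroup T] [NormedSpace ℝ T] [FiniteDimensional ℝ T]
    (hd : Module.finrank ℝ Z = Module.finrank ℝ T) {F : Z × P → T} (hF : ContDiff ℝ ∞ F)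
    {S : Set (Z × P)} (hS0 : ∀ x ∈ S, F x = 0)
    (hS : ∀ x ∈ S, Function.Surjective (fderiv ℝ F x)) :
    Dense {q | ∀ z, (z, q) ∈ S → ∀ v, fderiv ℝ F (z, q) (v, 0) = 0 → v = 0} := by
  let _ : MeasurableSpace P := borel P
  have : BorelSpace P := ⟨rfl⟩
  have : ProperSpace P := FiniteDimensional.proper ℝ P
  have : ProperSpace Z := FiniteDimensional.proper ℝ Z
  have : CompleteSpace (Z × P) := FiniteDimensional.complete ℝ _
  set bad : Set (Z × P) := {x | x ∈ S ∧ ∃ v, v ≠ 0 ∧ fderiv ℝ F x (v, 0) = 0} with hbad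
  -- Near a bad point the zero set of `F` is parametrized by the kernel `K` of the differential,
  -- which has the dimension of `P`. Bad parameters are then critical values of the projection `m :
  -- K → P` of the zero set.
  have hloc : ∀ x ∈ bad, ∃ U ∈ 𝓝 x, (Measure.addHaar : Measure P) (Prod.snd '' (U ∩ bad)) = 0 := by
    intro x₀ hx₀
    set A := fderiv ℝ F x₀ with hA
    have hAs : Function.Surjective A := hS x₀ hx₀.1
    set K := LinearMap.ker (A : (Z × P) →ₗ[ℝ] T) with hK
    obtain ⟨π₀, hπ₀⟩ := K.subtype.exists_leftInverse_of_injective K.ker_subtype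
    set π : (Z × P) →L[ℝ] K := LinearMap.toContinuousLinearMap π₀ with hπ
    have hπK : ∀ v : K, π (v : Z × P) = v := fun v => LinearMap.congr_fun hπ₀ v
    have hfin : Module.finrank ℝ T + Module.finrank ℝ K = Module.finrank ℝ (Z × P) := by
      have h1 := LinearMap.finrank_range_add_finrank_ker (A : (Z × P) →ₗ[ℝ] T)
      rwa [LinearMap.range_eq_top.2 hAs, finrank_top] at h1
    have hKP : Module.finrank ℝ K = Module.finrank ℝ P := by
      rw [Module.finrank_prod] at hfin
      omega
    set Θ : Z × P → T × K := fun x => (F x, π x) with hΘ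
    have hΘs : ContDiff ℝ ∞ Θ := hF.prodMk π.contDiff
    have hΘd : ∀ x, HasFDerivAt Θ ((fderiv ℝ F x).prod π) x := fun x =>
      ((hF.differentiable (by simp) x).hasFDerivAt).prodMk π.hasFDerivAt
    have hinj : Function.Injective (A.prod π) := by
      rw [injective_iff_map_eq_zero]
      intro v hv
      have h1 : A v = 0 := congrArg Prod.fst hv
      have h2 : π v = 0 := congrArg Prod.snd hv
      have h3 := hπK ⟨v, h1⟩
      rw [h2] at h3
      exact congrArg Subtype.val h3.symm
    obtain ⟨e, he⟩ := exists_continuousLinearEquiv_of_injective _ hinj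
      (by rw [Module.finrank_prod (R := ℝ) (M := T), hfin])
    have hder : HasFDerivAt Θ (e : (Z × P) →L[ℝ] (T × K)) x₀ := by
      rw [he]
      exact hΘd x₀
    have hΘx : ContDiffAt ℝ ∞ Θ x₀ := hΘs.contDiffAt
    set H := hΘx.toOpenPartialHomeomorph Θ hder (by simp) with hH
    have hxs : x₀ ∈ H.source := hΘx.mem_toOpenPartialHomeomorph_source hder (by simp)
    have hsm : ContDiffAt ℝ ∞ H.symm (Θ x₀) := hΘx.to_localInverse hder (by simp)
    have hev : ∀ᶠ y in 𝓝 (Θ x₀), DifferentiableAt ℝ H.symm y :=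
      ((hsm.of_le (m := 1) (by simp)).eventually (by simp)).mono
        fun y hy => hy.differentiableAt (by simp)
    refine ⟨_, inter_mem (H.open_source.mem_nhds hxs)
      (hΘs.continuous.continuousAt.preimage_mem_nhds hev), ?_⟩
    set m : K → P := fun κ => (H.symm (0, κ)).2 with hm
    set m' : K → K →L[ℝ] P := fun κ => (ContinuousLinearMap.snd ℝ Z P).comp
      ((fderiv ℝ H.symm (0, κ)).comp (ContinuousLinearMap.inr ℝ T K)) with hm'
    set s : Set K := {κ | DifferentiableAt ℝ H.symm (0, κ) ∧ ¬ Function.Injective (m' κ)} with hs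
    have hnull : (Measure.addHaar : Measure P) (m '' s) = 0 := by
      refine addHaar_image_eq_zero_of_not_injective _ hKP (f' := m') (fun κ hκ => ?_)
        fun κ hκ => hκ.2
      exact (ContinuousLinearMap.snd ℝ Z P).hasFDerivAt.comp κ
        (hκ.1.hasFDerivAt.comp κ (hasFDerivAt_prodMk_right (0 : T) κ))
    refine measure_mono_null ?_ hnull
    rintro _ ⟨x, ⟨⟨hxsrc, hxd⟩, hxS, v, hv, hFv⟩, rfl⟩
    have hΘ0 : Θ x = (0, π x) := by rw [hΘ]; simp only [hS0 x hxS]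
    have hxd' : DifferentiableAt ℝ H.symm (0, π x) := by rw [← hΘ0]; exact hxd
    have hleft : H.symm (0, π x) = x := by rw [← hΘ0]; exact H.left_inv hxsrc
    refine ⟨π x, ⟨hxd', ?_⟩, by simp only [hm, hleft]⟩
    have hcomp : (fderiv ℝ H.symm (0, π x)).comp ((fderiv ℝ F x).prod π)
        = ContinuousLinearMap.id ℝ (Z × P) := by
      have h1 : HasFDerivAt (fun y => H.symm (Θ y))
          ((fderiv ℝ H.symm (0, π x)).comp ((fderiv ℝ F x).prod π)) x := by
        refine HasFDerivAt.comp x ?_ (hΘd x)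
        rw [hΘ0]
        exact hxd'.hasFDerivAt
      refine h1.unique ((hasFDerivAt_id x).congr_of_eventuallyEq ?_)
      filter_upwards [H.open_source.mem_nhds hxsrc] with y hy
      exact H.left_inv hy
    -- The vector `(v, 0)` is tangent to the zero set and projects to zero in `P`, so it is a kernel
    -- vector for `m`.
    have h2 : fderiv ℝ H.symm (0, π x) (0, π (v, 0)) = (v, 0) := by
      have := congrArg (fun B : (Z × P) →L[ℝ] (Z × P) => B (v, 0)) hcomp
      simpa [hFv] using this
    intro hinj'
    have h3 : π (v, 0) = 0 := by
      apply hinj'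
      rw [map_zero]
      have : m' (π x) (π (v, 0)) = (fderiv ℝ H.symm (0, π x) (0, π (v, 0))).2 := rfl
      rw [this, h2]
    rw [h3] at h2
    have h4 : ((v, 0) : Z × P) = 0 := by
      rw [← h2]
      exact map_zero (fderiv ℝ H.symm (0, π x))
    exact hv (congrArg Prod.fst h4)
  choose! U hU hUnull using hloc
  -- The Lindelöf property makes the local null sets countable in number.
  obtain ⟨t, htb, htc, hcov⟩ := TopologicalSpace.countable_cover_nhdsWithin
    (f := U) (s := bad) fun x hx => mem_nhdsWithin_of_mem_nhds (hU x hx)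
  have hbad0 : (Measure.addHaar : Measure P) (Prod.snd '' bad) = 0 := by
    have h1 : Prod.snd '' bad ⊆ ⋃ x ∈ t, Prod.snd '' (U x ∩ bad) := by
      rintro _ ⟨x, hx, rfl⟩
      obtain ⟨y, hy, hxy⟩ := mem_iUnion₂.1 (hcov hx)
      exact mem_iUnion₂.2 ⟨y, hy, x, ⟨hxy, hx⟩, rfl⟩
    exact measure_mono_null h1 ((measure_biUnion_null_iff htc).2 fun x hx => hUnull x (htb hx))
  refine Measure.dense_of_ae (μ := (Measure.addHaar : Measure P)) ?_
  have h1 : ∀ᵐ q ∂(Measure.addHaar : Measure P), q ∉ Prod.snd '' bad :=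
    measure_eq_zero_iff_ae_notMem.1 hbad0
  filter_upwards [h1] with q hq z hz v hv
  by_contra hv0
  exact hq ⟨(z, q), ⟨hz, v, hv0, hv⟩, rfl⟩

end HolFol

/-! ### Homogeneous first integrals and Lagrange's second order condition. -/

namespace HolFol
open Set Filter Topology

/-- A homogeneous holomorphic function of degree `k` with no critical point but the origin. -/
structure IsHomogeneousIntegral {n : ℕ} (k : ℕ) (f : Cn n → ℂ) : Prop where
  contDiff : ContDiff ℂ ∞ f
  map_smul : ∀ (μ : ℂ) z, f (μ • z) = μ ^ k * f z
  fderiv_ne_zero : ∀ z, z ≠ 0 → fderiv ℂ f z ≠ 0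

/-- Stated for vector values and a single `μ` so as to apply to `f` and also to its differential,
whose homogeneity is only available for `μ ≠ 0`. -/
lemma fderiv_smul_of_homogeneous {E V : Type*} [NormedAddCommGroup E] [NormedSpace ℂ E]
    [NormedAddCommGroup V] [NormedSpace ℂ V] {g : E → V} (hg : Differentiable ℂ g) {k : ℕ} {μ : ℂ}
    (hhom : ∀ z, g (μ • z) = μ ^ k • g z) (z δ : E) :
    fderiv ℂ g (μ • z) (μ • δ) = μ ^ k • fderiv ℂ g z δ := by
  have h1 : HasFDerivAt (fun w => g (μ • w))
      ((fderiv ℂ g (μ • z)).comp (μ • ContinuousLinearMap.id ℂ E)) z :=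
    HasFDerivAt.comp z (hg (μ • z)).hasFDerivAt ((hasFDerivAt_id z).const_smul μ)
  have h2 : HasFDerivAt (fun w => g (μ • w)) (μ ^ k • fderiv ℂ g z) z := by
    rw [show (fun w => g (μ • w)) = fun w => μ ^ k • g w from funext hhom]
    exact (hg z).hasFDerivAt.const_smul _
  exact congrArg (fun A : E →L[ℂ] V => A δ) (h1.unique h2)

namespace IsHomogeneousIntegral

variable {n k : ℕ} {f : Cn n → ℂ} (hf : IsHomogeneousIntegral k f)
include hf

lemma differentiable : Differentiable ℂ f := hf.contDiff.differentiable (by simp)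

lemma fderiv_smul (μ : ℂ) (z δ : Cn n) :
    fderiv ℂ f (μ • z) (μ • δ) = μ ^ k * fderiv ℂ f z δ :=
  fderiv_smul_of_homogeneous hf.differentiable (hf.map_smul μ) z δ

/-- Euler's identity, by differentiating `f (μ • z)` at `μ = 1`. -/
lemma fderiv_self (z : Cn n) : fderiv ℂ f z z = k * f z := by
  have h1 : HasDerivAt (fun μ : ℂ => f (μ • z)) (fderiv ℂ f z z) 1 := by
    have h2 : HasDerivAt (fun μ : ℂ => μ • z) z 1 := by
      simpa using (hasDerivAt_id (1 : ℂ)).smul_const z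
    have h3 : HasFDerivAt f (fderiv ℂ f z) ((1 : ℂ) • z) := by
      rw [one_smul]
      exact (hf.differentiable z).hasFDerivAt
    exact h3.comp_hasDerivAt 1 h2
  have h2 : HasDerivAt (fun μ : ℂ => f (μ • z)) (k * f z) 1 := by
    rw [show (fun μ : ℂ => f (μ • z)) = fun μ => μ ^ k * f z from
      funext fun μ => hf.map_smul μ z]
    simpa using (hasDerivAt_pow k (1 : ℂ)).mul_const (f z)
  exact h1.unique h2

lemma fderiv_smul_eq {μ : ℂ} (hμ : μ ≠ 0) (hk : k ≠ 0) (z : Cn n) :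
    fderiv ℂ f (μ • z) = μ ^ (k - 1) • fderiv ℂ f z := by
  obtain ⟨m, rfl⟩ := Nat.exists_eq_succ_of_ne_zero hk
  ext δ
  have h := hf.fderiv_smul μ z δ
  rw [_root_.map_smul, smul_eq_mul, pow_succ', mul_assoc] at h
  simpa using mul_left_cancel₀ hμ h

lemma fderiv_fderiv_smul {μ : ℂ} (hμ : μ ≠ 0) (hk : k ≠ 0) (z δ : Cn n) :
    fderiv ℂ (fderiv ℂ f) (μ • z) (μ • δ) = μ ^ (k - 1) • fderiv ℂ (fderiv ℂ f) z δ :=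
  fderiv_smul_of_homogeneous ((hf.contDiff.fderiv_right (m := ∞) (by simp)).differentiable
    (by simp)) (hf.fderiv_smul_eq hμ hk) z δ

end IsHomogeneousIntegral

/-- The Hessian of a holomorphic function, applied to a vector and turned into a vector. -/
noncomputable def hessVec {n : ℕ} (f : Cn n → ℂ) (z : Cn n) : Cn n →L[ℝ] Cn n :=
  (rieszReal n).comp ((fderiv ℂ (fderiv ℂ f) z).restrictScalars ℝ)

lemma hessVec_apply {n : ℕ} (f : Cn n → ℂ) (z δ : Cn n) :
    hessVec f z δ = rieszReal n (fderiv ℂ (fderiv ℂ f) z δ) := rfl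

lemma hasFDerivAt_grad {n : ℕ} {f : Cn n → ℂ} (hf : ContDiff ℂ ∞ f) (z : Cn n) :
    HasFDerivAt (grad f) (hessVec f z) z := by
  have h1 : HasFDerivAt (fderiv ℂ f) (fderiv ℂ (fderiv ℂ f) z) z :=
    ((hf.fderiv_right (m := ∞) (by simp)).differentiable (by simp) z).hasFDerivAt
  exact (rieszReal n).hasFDerivAt.comp z (h1.restrictScalars ℝ)

/-- The real part of the Hermitian product. -/
noncomputable def reInner (n : ℕ) : Cn n →L[ℝ] Cn n →L[ℝ] ℝ := innerSL ℝ

lemma reInner_apply {n : ℕ} (x y : Cn n) : reInner n x y = (inner ℂ x y : ℂ).re := by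
  rw [reInner, innerSL_apply_apply, PiLp.inner_apply, PiLp.inner_apply, Complex.re_sum]
  rfl

/-- The multiplier rule. The part `v` of `y` orthogonal to `x` is itself a test vector, and pairing
it with `y` gives `‖v‖ ^ 2`. -/
lemma exists_eq_smul_of_re_inner {n : ℕ} {x y : Cn n}
    (h : ∀ v, inner ℂ x v = 0 → (inner ℂ y v : ℂ).re = 0) : ∃ c : ℂ, y = c • x := by
  set c : ℂ := inner ℂ x y / inner ℂ x x with hc
  refine ⟨c, ?_⟩
  set v := y - c • x with hv
  have hxv : inner ℂ x v = 0 := by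
    rw [hv, inner_sub_right, inner_smul_right, hc]
    rcases eq_or_ne x 0 with rfl | hx
    · simp
    · rw [div_mul_cancel₀ _ (inner_self_ne_zero.2 hx), sub_self]
  have h1 := h v hxv
  have h2 : y = v + c • x := by rw [hv]; abel
  rw [h2, inner_add_left, inner_smul_left, hxv, mul_zero, add_zero] at h1
  have h3 : v = 0 := by
    rw [← inner_self_eq_zero (𝕜 := ℂ), inner_self_eq_norm_sq_to_K]
    have := inner_self_eq_norm_sq (𝕜 := ℂ) v
    have h4 : ‖v‖ ^ 2 = 0 := by rw [← this]; exact h1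
    rw [← RCLike.ofReal_pow, h4]
    simp
  exact sub_eq_zero.1 h3

/-- Nondegeneracy, on the tangent space of a level of `f`, of the Hessian of the Lagrangian of a
function with gradient `T` and of `f`, with multiplier `c`. -/
def LagrangeNondegenerate {n : ℕ} (T : Cn n →L[ℂ] Cn n) (f : Cn n → ℂ) (z : Cn n) (c : ℂ) : Prop :=
  ∀ (δ : Cn n) (τ : ℂ), fderiv ℂ f z δ = 0 → T δ - c • hessVec f z δ = τ • grad f z → δ = 0

/-- The second derivative of `φ` enters the chain rule only through `G'`, which vanishes at the
point. -/
lemma hessian_comp {V W : Type*} [NormedAddCommGroup V] [NormedSpace ℝ V] [NormedAddCommGroup W]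
    [NormedSpace ℝ W] {φ : V → W} {x : V} (hφ : ContDiffAt ℝ ∞ φ x) {G : W → ℝ}
    {G' : W → W →L[ℝ] ℝ} {G'' : W →L[ℝ] W →L[ℝ] ℝ} (hG : ∀ w, HasFDerivAt G (G' w) w)
    (hG' : HasFDerivAt G' G'' (φ x)) (hcrit : G' (φ x) = 0) (u v : V) :
    hessian (G ∘ φ) x u v = G'' (fderiv ℝ φ x u) (fderiv ℝ φ x v) := by
  have h1 : fderiv ℝ (G ∘ φ) =ᶠ[𝓝 x] fun y => (G' (φ y)).comp (fderiv ℝ φ y) := by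
    filter_upwards [(hφ.of_le (m := 1) (by simp)).eventually (by simp)] with y hy
    exact ((hG (φ y)).comp y (hy.differentiableAt (by simp)).hasFDerivAt).fderiv
  have h2 : HasFDerivAt (fderiv ℝ φ) (fderiv ℝ (fderiv ℝ φ) x) x :=
    ((hφ.fderiv_right (m := ∞) (by simp)).differentiableAt (by simp)).hasFDerivAt
  have h3 : HasFDerivAt (fun y => G' (φ y)) (G''.comp (fderiv ℝ φ x)) x :=
    hG'.comp x (hφ.differentiableAt (by simp)).hasFDerivAt
  rw [hessian, h1.fderiv_eq, (h3.clm_comp h2).fderiv, hcrit]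
  simp

/-- A contact satisfying Lagrange's second order condition is nondegenerate on its leaf. -/
theorem isNondegenerateOnLeaf_of_lagrangeNondegenerate {n : ℕ} {T : Cn n →L[ℂ] Cn n}
    {f : Cn n → ℂ} (hf : ContDiff ℂ ∞ f) {g : Cn n → ℝ}
    (hg : ∀ w, HasFDerivAt g (reInner n (T w)) w) {z : Cn n} (hz : fderiv ℂ f z ≠ 0) {c : ℂ}
    (hc : T z = c • grad f z) (hnd : LagrangeNondegenerate T f z c) :
    IsNondegenerateOnLeaf f g z := by
  rintro φ ⟨hφ0, hφs, hφi, hφc⟩ u hu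
  set A := fderiv ℝ φ 0 with hA
  have hφd : HasFDerivAt φ A 0 := (hφs.differentiableAt (by simp)).hasFDerivAt
  have hfd : ∀ w, HasFDerivAt f ((fderiv ℂ f w).restrictScalars ℝ) w := fun w =>
    ((hf.differentiable (by simp) w).hasFDerivAt).restrictScalars ℝ
  have hfA : ∀ v, fderiv ℂ f z (A v) = 0 := by
    intro v
    have h1 : HasFDerivAt (fun y => f (φ y)) (((fderiv ℂ f z).restrictScalars ℝ).comp A) 0 :=
      HasFDerivAt.comp (g := f) 0 (by rw [hφ0]; exact hfd z) hφd
    have h2 := h1.unique ((hasFDerivAt_const (f z) _).congr_of_eventuallyEq hφc)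
    exact congrArg (fun B : _ →L[ℝ] ℂ => B v) h2
  -- The range of `A` lies in the tangent space, and both have real dimension `2 * (n - 1)`.
  have hrange : ∀ w, fderiv ℂ f z w = 0 → ∃ v, A v = w := by
    set l : Cn n →ₗ[ℝ] ℂ := ((fderiv ℂ f z).restrictScalars ℝ).toLinearMap with hl
    have hsurj : LinearMap.range l = ⊤ := by
      rw [LinearMap.range_eq_top]
      intro y
      obtain ⟨x, hx⟩ : ∃ x, fderiv ℂ f z x ≠ 0 := by
        by_contra! hcon
        exact hz (ContinuousLinearMap.ext hcon)
      refine ⟨(y / fderiv ℂ f z x) • x, ?_⟩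
      change fderiv ℂ f z ((y / fderiv ℂ f z x) • x) = y
      rw [map_smul, smul_eq_mul, div_mul_cancel₀ _ hx]
    have h1 := LinearMap.finrank_range_add_finrank_ker l
    rw [hsurj, finrank_top, Complex.finrank_real_complex, finrank_real_of_complex,
      finrank_euclideanSpace_fin] at h1
    have h2 : LinearMap.range A.toLinearMap ≤ LinearMap.ker l := by
      rintro _ ⟨v, rfl⟩
      exact hfA v
    have h3 : Module.finrank ℝ (LinearMap.range A.toLinearMap) = 2 * (n - 1) := by
      rw [LinearMap.finrank_range_of_inj hφi, finrank_euclideanSpace_fin]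
    have h4 := Submodule.eq_of_le_of_finrank_le h2 (by omega)
    intro w hw
    have h5 : w ∈ LinearMap.ker l := hw
    rw [← h4] at h5
    exact h5
  -- The Lagrangian: it differs from `g` by a constant on the leaf, and `z` is a critical point of
  -- it in the whole space.
  set G : Cn n → ℝ := fun w => g w - ((starRingEnd ℂ) c * f w).re with hG
  have hGd : ∀ w, HasFDerivAt G (reInner n (T w - c • grad f w)) w := by
    intro w
    have h1 := (hg w).sub (Complex.reCLM.hasFDerivAt.comp w
      ((hfd w).const_mul ((starRingEnd ℂ) c)))
    have h2 : reInner n (T w - c • grad f w) = reInner n (T w) - Complex.reCLM.comp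
        ((starRingEnd ℂ) c • (fderiv ℂ f w).restrictScalars ℝ) := by
      refine ContinuousLinearMap.ext fun v => ?_
      rw [reInner_apply, inner_sub_left, inner_smul_left, inner_grad, Complex.sub_re,
        sub_apply, reInner_apply]
      rfl
    rw [h2]
    exact h1
  have hGd' : HasFDerivAt (fun w => reInner n (T w - c • grad f w))
      ((reInner n).comp (T.restrictScalars ℝ - c • hessVec f z)) (φ 0) := by
    rw [hφ0]
    exact (reInner n).hasFDerivAt.comp z
      (((T.restrictScalars ℝ).hasFDerivAt).sub ((hasFDerivAt_grad hf z).const_smul c))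
  have hhess : ∀ v, (inner ℂ (T (A u) - c • hessVec f z (A u)) (A v) : ℂ).re = 0 := by
    intro v
    have h1 := hessian_comp hφs hGd hGd' (by rw [hφ0, hc, sub_self, map_zero]) u v
    have h2 : fderiv ℝ (G ∘ φ) =ᶠ[𝓝 0] fderiv ℝ (g ∘ φ) := by
      have h3 : G ∘ φ =ᶠ[𝓝 0] fun y => (g ∘ φ) y - ((starRingEnd ℂ) c * f z).re := by
        filter_upwards [hφc] with y hy
        simp [hG, hy]
      refine h3.fderiv.trans (Eventually.of_forall fun y => ?_)
      exact fderiv_sub_const _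
    have h4 : hessian (G ∘ φ) 0 = hessian (g ∘ φ) 0 := h2.fderiv_eq
    rw [h4, hu v] at h1
    rw [← reInner_apply]
    exact h1.symm
  obtain ⟨τ, hτ⟩ := exists_eq_smul_of_re_inner (x := grad f z)
    (y := T (A u) - c • hessVec f z (A u)) fun w hw => by
      rw [inner_grad] at hw
      obtain ⟨v, rfl⟩ := hrange w hw
      exact hhess v
  have h0 := hnd (A u) τ (hfA u) hτ
  exact hφi (h0.trans (map_zero A).symm)

end HolFol

/-! ### Contacts of a foliation with ellipsoids. -/

namespace HolFol
open Set Filter Topology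

lemma Q_eq_norm_sq {n : ℕ} (z : Cn n) : Q z = ‖z‖ ^ 2 := by
  rw [Q, EuclideanSpace.norm_sq_eq]

lemma Q_eq_re_inner {n : ℕ} (z : Cn n) : Q z = (inner ℂ z z : ℂ).re := by
  rw [Q_eq_norm_sq]
  exact (inner_self_eq_norm_sq (𝕜 := ℂ) z).symm

/-- The gradient of the quadratic form `z ↦ Q (B z)`. -/
noncomputable def sqGrad {n : ℕ} (B : Cn n →L[ℂ] Cn n) : Cn n →L[ℂ] Cn n :=
  (2 : ℂ) • (ContinuousLinearMap.adjoint B).comp B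

lemma inner_sqGrad {n : ℕ} (B : Cn n →L[ℂ] Cn n) (z v : Cn n) :
    inner ℂ (sqGrad B z) v = 2 * inner ℂ (B z) (B v) := by
  rw [sqGrad, smul_apply, inner_smul_left, ContinuousLinearMap.comp_apply,
    ContinuousLinearMap.adjoint_inner_left, Complex.conj_ofNat]

lemma hasFDerivAt_Q_comp {n : ℕ} (B : Cn n →L[ℂ] Cn n) (z : Cn n) :
    HasFDerivAt (fun z => Q (B z)) (reInner n (sqGrad B z)) z := by
  have h1 : HasFDerivAt (fun w => reInner n (B w) (B w)) _ z :=
    ((reInner n).hasFDerivAt.comp z (B.restrictScalars ℝ).hasFDerivAt).clm_apply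
      (B.restrictScalars ℝ).hasFDerivAt
  have h2 : (fun z => Q (B z)) = fun w => reInner n (B w) (B w) := by
    funext w
    rw [reInner_apply, Q_eq_re_inner]
  rw [h2]
  refine h1.congr_fderiv (ContinuousLinearMap.ext fun v => ?_)
  rw [reInner_apply, inner_sqGrad]
  have h3 : (inner ℂ (B v) (B z) : ℂ).re = (inner ℂ (B z) (B v) : ℂ).re := by
    rw [← inner_conj_symm, Complex.conj_re]
  calc reInner n (B z) (B v) + reInner n (B v) (B z)
      = 2 * (inner ℂ (B z) (B v) : ℂ).re := by rw [reInner_apply, reInner_apply, h3]; ring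
    _ = _ := by simp

lemma isContact_iff_exists_multiplier {n : ℕ} {T : Cn n →L[ℂ] Cn n} {f : Cn n → ℂ} {g : Cn n → ℝ}
    {z : Cn n} (hg : HasFDerivAt g (reInner n (T z)) z) :
    IsContact f g z ↔ ∃ c : ℂ, T z = c • grad f z := by
  constructor
  · intro h
    refine exists_eq_smul_of_re_inner fun v hv => ?_
    rw [inner_grad] at hv
    have := h v hv
    rwa [hg.fderiv, reInner_apply] at this
  · rintro ⟨c, hc⟩ v hv
    rw [hg.fderiv, reInner_apply, hc, inner_smul_left, inner_grad, hv]
    simp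

section QuadraticForm

variable {n k : ℕ} {f : Cn n → ℂ} {B : Cn n →L[ℂ] Cn n}

/-- The multiplier at a contact is determined by the values of the two functions. -/
lemma multiplier_eq (hf : IsHomogeneousIntegral k f) (hk : k ≠ 0) {z : Cn n} (hz : f z ≠ 0) {c : ℂ}
    (hc : sqGrad B z = c • grad f z) :
    c = 2 * (Q (B z) : ℂ) / (k * (starRingEnd ℂ) (f z)) := by
  -- Lagrange's equation is paired with `z`; Euler's identity evaluates the other side.
  have h1 : inner ℂ z (sqGrad B z) = 2 * (Q (B z) : ℂ) := by
    rw [← inner_conj_symm, inner_sqGrad, Q_eq_norm_sq, inner_self_eq_norm_sq_to_K, map_mul,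
      Complex.conj_ofNat]
    simp
  rw [hc, inner_smul_right, ← inner_conj_symm, inner_grad, hf.fderiv_self, map_mul,
    Complex.conj_natCast] at h1
  rw [eq_div_iff (mul_ne_zero (Nat.cast_ne_zero.2 hk)
    ((map_ne_zero (starRingEnd ℂ)).2 hz)), h1]

/-- By Euler's identity the radial vector is tangent to the zero level, while the radial derivative
`2 * Q (B z)` is positive. -/
lemma not_isContact_of_eq_zero (hf : IsHomogeneousIntegral k f) (hB : ∀ z, B z = 0 → z = 0)
    {z : Cn n} (hz : z ≠ 0) (hfz : f z = 0) : ¬ IsContact f (fun z => Q (B z)) z := by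
  intro h
  have h1 := h z (by rw [hf.fderiv_self, hfz, mul_zero])
  rw [(hasFDerivAt_Q_comp B z).fderiv, reInner_apply, inner_sqGrad] at h1
  have h2 : (2 * inner ℂ (B z) (B z) : ℂ).re = 2 * Q (B z) := by
    rw [Q_eq_re_inner]; simp
  rw [h2, Q_eq_norm_sq] at h1
  exact hz (hB z (by simpa using h1))

/-- The derivative of Lagrange's equations, in the point and the multiplier. -/
noncomputable def lagrangeDeriv (T : Cn n →L[ℂ] Cn n) (f : Cn n → ℂ) (z : Cn n) (c : ℂ) :
    Cn n × ℂ →L[ℝ] Cn n × ℂ :=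
  ((T.restrictScalars ℝ).comp (ContinuousLinearMap.fst ℝ (Cn n) ℂ) -
    (c • (hessVec f z).comp (ContinuousLinearMap.fst ℝ (Cn n) ℂ) +
      (ContinuousLinearMap.snd ℝ (Cn n) ℂ).smulRight (grad f z))).prod
    (((fderiv ℂ f z).restrictScalars ℝ).comp (ContinuousLinearMap.fst ℝ (Cn n) ℂ))

lemma lagrangeDeriv_apply (T : Cn n →L[ℂ] Cn n) (f : Cn n → ℂ) (z : Cn n) (c : ℂ) (δ : Cn n)
    (α : ℂ) : lagrangeDeriv T f z c (δ, α) =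
      (T δ - (c • hessVec f z δ + α • grad f z), fderiv ℂ f z δ) := rfl

lemma hasFDerivAt_lagrange (hf : ContDiff ℂ ∞ f) (T : Cn n →L[ℂ] Cn n) (z : Cn n) (c : ℂ) :
    HasFDerivAt (fun x : Cn n × ℂ => (T x.1 - x.2 • grad f x.1, f x.1))
      (lagrangeDeriv T f z c) (z, c) := by
  have h1 : HasFDerivAt (fun x : Cn n × ℂ => T x.1)
      ((T.restrictScalars ℝ).comp (ContinuousLinearMap.fst ℝ (Cn n) ℂ)) (z, c) :=
    (T.restrictScalars ℝ).hasFDerivAt.comp (z, c) hasFDerivAt_fst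
  have h2 : HasFDerivAt (fun x : Cn n × ℂ => grad f x.1)
      ((hessVec f z).comp (ContinuousLinearMap.fst ℝ (Cn n) ℂ)) (z, c) :=
    HasFDerivAt.comp (z, c) (f := Prod.fst) (hasFDerivAt_grad hf z) hasFDerivAt_fst
  have h3 : HasFDerivAt (fun x : Cn n × ℂ => f x.1)
      (((fderiv ℂ f z).restrictScalars ℝ).comp (ContinuousLinearMap.fst ℝ (Cn n) ℂ)) (z, c) :=
    HasFDerivAt.comp (z, c) (f := Prod.fst)
      (((hf.differentiable (by simp) z).hasFDerivAt).restrictScalars ℝ) hasFDerivAt_fst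
  exact (h1.sub ((hasFDerivAt_snd (𝕜 := ℝ) (p := (z, c))).smul h2)).prodMk h3

/-- The `τ` of the second order condition is the variation of the multiplier; it vanishes with `δ`
because the gradient of `f` is nonzero. -/
lemma injective_lagrangeDeriv_iff (hf : IsHomogeneousIntegral k f) {T : Cn n →L[ℂ] Cn n} {z : Cn n}
    (hz : z ≠ 0) {c : ℂ} :
    (∀ v, lagrangeDeriv T f z c v = 0 → v = 0) ↔ LagrangeNondegenerate T f z c := by
  constructor
  · intro h δ τ hδ hτ
    have h1 := h (δ, τ) (by
      rw [lagrangeDeriv_apply, hδ, ← sub_sub, hτ, sub_self]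
      rfl)
    exact congrArg Prod.fst h1
  · rintro h ⟨δ, τ⟩ hv
    rw [lagrangeDeriv_apply, Prod.mk_eq_zero, ← sub_sub, sub_eq_zero] at hv
    have hδ := h δ τ hv.2 hv.1
    have h1 := hv.1
    rw [hδ, map_zero, map_zero, smul_zero, sub_zero, eq_comm, smul_eq_zero] at h1
    have h2 : grad f z ≠ 0 := by
      rw [grad, Ne, rieszReal_eq_zero]
      exact hf.fderiv_ne_zero z hz
    rw [hδ, h1.resolve_right h2]
    rfl

/-- On a level of `f`, the contacts with bounded values of the quadratic form are finite in number
when Lagrange's condition holds at all of them. -/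
lemma finite_setOf_isContact (hf : IsHomogeneousIntegral k f) (hk : k ≠ 0)
    {B' : Cn n →L[ℂ] Cn n} (hB : ∀ z, B' (B z) = z) {a : ℂ} (ha : a ≠ 0)
    (hnd : ∀ z c, f z = a → sqGrad B z = c • grad f z → LagrangeNondegenerate (sqGrad B) f z c)
    (r : ℝ) : {z | f z = a ∧ IsContact f (fun z => Q (B z)) z ∧ Q (B z) ≤ r}.Finite := by
  -- On one level the multiplier is a continuous function of the point, which makes the set of
  -- contacts closed.
  set m : Cn n → ℂ := fun z => 2 * (Q (B z) : ℂ) / (k * (starRingEnd ℂ) a) with hm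
  have hQ : Continuous fun z => Q (B z) := by
    simp_rw [Q_eq_norm_sq]
    fun_prop
  have hmc : Continuous m := by
    have : Continuous fun z => (Q (B z) : ℂ) := Complex.continuous_ofReal.comp hQ
    exact (continuous_const.mul this).div_const _
  have hfc : Continuous f := hf.contDiff.continuous
  have hgc : Continuous (grad f) := (contDiff_grad hf.contDiff).continuous
  set C := {z | f z = a ∧ IsContact f (fun z => Q (B z)) z ∧ Q (B z) ≤ r} with hC
  have hmult : ∀ z ∈ C, sqGrad B z = m z • grad f z := by
    rintro z ⟨hz, hct, -⟩
    obtain ⟨c, hc⟩ := (isContact_iff_exists_multiplier (hasFDerivAt_Q_comp B z)).1 hct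
    have h1 := multiplier_eq hf hk (by rw [hz]; exact ha) hc
    rw [hz] at h1
    rw [hc, h1]
  have hCeq : C = {z | f z = a} ∩ {z | sqGrad B z = m z • grad f z} ∩ {z | Q (B z) ≤ r} := by
    ext z
    constructor
    · exact fun h => ⟨⟨h.1, hmult z h⟩, h.2.2⟩
    · rintro ⟨⟨h1, h2⟩, h3⟩
      exact ⟨h1, (isContact_iff_exists_multiplier (hasFDerivAt_Q_comp B z)).2 ⟨_, h2⟩, h3⟩
  have hclosed : IsClosed C := by
    rw [hCeq]
    refine ((isClosed_eq hfc continuous_const).inter (isClosed_eq ?_ (hmc.smul hgc))).inter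
      (isClosed_le hQ continuous_const)
    exact (sqGrad B).continuous
  have hbdd : Bornology.IsBounded C := by
    refine isBounded_iff_forall_norm_le.2 ⟨‖B'‖ * √r, fun z hz => ?_⟩
    have h1 : ‖B z‖ ≤ √r := by
      apply Real.le_sqrt_of_sq_le
      rw [← Q_eq_norm_sq]
      exact hz.2.2
    calc ‖z‖ = ‖B' (B z)‖ := by rw [hB]
      _ ≤ ‖B'‖ * ‖B z‖ := B'.le_opNorm _
      _ ≤ ‖B'‖ * √r := by gcongr
  have hcomp : IsCompact C := Metric.isCompact_of_isClosed_isBounded hclosed hbdd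
  by_contra hinf
  obtain ⟨z, hzC, hacc⟩ := Set.Infinite.exists_accPt_of_subset_isCompact hinf hcomp subset_rfl
  have hz0 : z ≠ 0 := by
    rintro rfl
    have h1 := hf.map_smul 0 0
    rw [zero_pow hk, zero_mul, smul_zero, hzC.1] at h1
    exact ha h1
  have hinj := (injective_lagrangeDeriv_iff hf hz0).2 (hnd z (m z) hzC.1 (hmult z hzC))
  obtain ⟨e, he⟩ := exists_continuousLinearEquiv_of_injective _
    ((injective_iff_map_eq_zero _).2 hinj) rfl
  -- An injective derivative isolates solutions of Lagrange's equations, contradicting accumulation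
  -- at `z`.
  have hne := (hasFDerivAt_lagrange hf.contDiff (sqGrad B) z (m z)).eventually_ne
    (c := ((0 : Cn n), a)) (by rw [← he]; exact ⟨_, e.antilipschitz⟩)
  have htend : Tendsto (fun w => (w, m w)) (𝓝[≠] z) (𝓝[≠] (z, m z)) := by
    refine tendsto_nhdsWithin_iff.2 ⟨?_, ?_⟩
    · exact ((continuous_id.prodMk hmc).tendsto z).mono_left nhdsWithin_le_nhds
    · filter_upwards [self_mem_nhdsWithin] with w hw h
      exact hw (congrArg Prod.fst h)
  obtain ⟨w, hwC, hw⟩ :=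
    ((accPt_iff_frequently_nhdsNE.1 hacc).and_eventually (htend.eventually hne)).exists
  apply hw
  rw [hmult w hwC, sub_self, hwC.1]

/-- If all contacts of the foliation with the quadratic form `z ↦ Q (B z)` satisfy Lagrange's
condition, then the form restricts to Morse functions on the leaves. -/
theorem carriesMorseStructure_of_lagrangeNondegenerate (hf : IsHomogeneousIntegral k f)
    (hk : k ≠ 0) {B' : Cn n →L[ℂ] Cn n} (hB : ∀ z, B' (B z) = z)
    (hnd : ∀ z c, f z ≠ 0 → sqGrad B z = c • grad f z → LagrangeNondegenerate (sqGrad B) f z c) :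
    CarriesMorseStructure f fun z => Q (B z) := by
  refine ⟨?_, ?_⟩
  · have h1 : ContDiff ℝ ∞ fun z : Cn n => ‖B z‖ ^ 2 :=
      (contDiff_norm_sq ℂ).comp (B.restrictScalars ℝ).contDiff
    simp_rw [Q_eq_norm_sq]
    exact h1.contDiffOn
  · rintro _ ⟨z₀, -, rfl⟩
    have hleaf : ∀ z ∈ leaf f z₀, z ≠ 0 ∧ f z = f z₀ := fun z hz =>
      connectedComponentIn_subset {w | w ≠ 0 ∧ f w = f z₀} z₀ hz
    have hB0 : ∀ z, B z = 0 → z = 0 := fun z hz => by rw [← hB z, hz, map_zero]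
    have hfz : ∀ z ∈ leaf f z₀, IsContact f (fun z => Q (B z)) z → f z ≠ 0 := fun z hz hct h0 =>
      not_isContact_of_eq_zero hf hB0 (hleaf z hz).1 h0 hct
    refine ⟨fun z hz hct => ?_, fun z hz hct => ?_⟩
    · have h0 : f z₀ ≠ 0 := by rw [← (hleaf z hz).2]; exact hfz z hz hct
      have hfin := finite_setOf_isContact hf hk hB h0
        (fun w c hw hc => hnd w c (by rw [hw]; exact h0) hc) (Q (B z) + 1)
      have hV := ((hfin.image fun w => Q (B w)).subset (sdiff_subset (t := {Q (B z)}))).isClosed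
      obtain ⟨ε, hε, hball⟩ := Metric.isOpen_iff.1 hV.isOpen_compl (Q (B z)) (by simp)
      -- The bound by `1` keeps nearby critical values below `Q (B z) + 1`, where only finitely many
      -- occur.
      refine ⟨min ε 1, by positivity, fun w hw hwct hlt => ?_⟩
      by_contra hne
      have h1 : Q (B w) ∈ Metric.ball (Q (B z)) ε := by
        rw [Metric.mem_ball, Real.dist_eq]
        exact hlt.trans_le (min_le_left _ _)
      refine hball h1 ⟨⟨w, ⟨(hleaf w hw).2, hwct, ?_⟩, rfl⟩, hne⟩
      have h2 := (abs_lt.1 (hlt.trans_le (min_le_right ε 1))).2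
      linarith
    · obtain ⟨c, hc⟩ := (isContact_iff_exists_multiplier (hasFDerivAt_Q_comp B z)).1 hct
      exact isNondegenerateOnLeaf_of_lagrangeNondegenerate hf.contDiff (hasFDerivAt_Q_comp B)
        (hf.fderiv_ne_zero z (hleaf z hz).1) hc (hnd z c (hfz z hz hct) hc)

end QuadraticForm

end HolFol

/-! ### Generic ellipsoids, and transport of Morse structures by isotopies. -/

namespace HolFol
open Set Filter Topology

section Generic

variable {n k : ℕ} {f : Cn n → ℂ}

/-- The adjoint of operators as a real-linear map. -/
noncomputable def adjointReal (n : ℕ) : (Cn n →L[ℂ] Cn n) →L[ℝ] (Cn n →L[ℂ] Cn n) :=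
  AddMonoidHom.toRealLinearMap
    ((ContinuousLinearMap.adjoint (𝕜 := ℂ) (E := Cn n) (F := Cn n)) :
      (Cn n →L[ℂ] Cn n) →+ (Cn n →L[ℂ] Cn n))
    (ContinuousLinearMap.adjoint (𝕜 := ℂ) (E := Cn n) (F := Cn n)).continuous

lemma adjointReal_apply (B : Cn n →L[ℂ] Cn n) :
    adjointReal n B = ContinuousLinearMap.adjoint B := rfl

lemma sqGrad_apply (B : Cn n →L[ℂ] Cn n) (z : Cn n) :
    sqGrad B z = (2 : ℂ) • adjointReal n B (B z) := rfl

/-- Lagrange's equations for the contacts of the level `1` of `f` with `z ↦ Q (B z)`, as a function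
of the point, the multiplier and `B`. -/
noncomputable def lagrangeEquations (f : Cn n → ℂ) (x : (Cn n × ℂ) × (Cn n →L[ℂ] Cn n)) :
    Cn n × ℂ :=
  (sqGrad x.2 x.1.1 - x.1.2 • grad f x.1.1, f x.1.1 - 1)

lemma contDiff_lagrangeEquations (hf : ContDiff ℂ ∞ f) : ContDiff ℝ ∞ (lagrangeEquations f) := by
  have happ : ContDiff ℝ ∞ fun q : (Cn n →L[ℂ] Cn n) × Cn n => q.1 q.2 :=
    (isBoundedBilinearMap_apply (𝕜 := ℂ)).contDiff.restrict_scalars ℝ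
  have h1 : ContDiff ℝ ∞ fun x : (Cn n × ℂ) × (Cn n →L[ℂ] Cn n) => x.2 x.1.1 :=
    happ.comp (contDiff_snd.prodMk contDiff_fst.fst)
  have h2 : ContDiff ℝ ∞ fun x : (Cn n × ℂ) × (Cn n →L[ℂ] Cn n) => adjointReal n x.2 (x.2 x.1.1) :=
    happ.comp (((adjointReal n).contDiff.comp contDiff_snd).prodMk h1)
  have h3 : ContDiff ℝ ∞ fun x : (Cn n × ℂ) × (Cn n →L[ℂ] Cn n) => x.1.2 • grad f x.1.1 :=
    contDiff_fst.snd.smul ((contDiff_grad hf).comp contDiff_fst.fst)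
  have hfr : ContDiff ℝ ∞ f := hf.restrict_scalars ℝ
  have h4 : ContDiff ℝ ∞ fun x : (Cn n × ℂ) × (Cn n →L[ℂ] Cn n) => f x.1.1 - 1 :=
    (hfr.comp contDiff_fst.fst).sub contDiff_const
  exact (((contDiff_const (c := (2 : ℂ))).smul h2).sub h3).prodMk h4

lemma fderiv_lagrangeEquations_left (hf : ContDiff ℂ ∞ f) (z : Cn n) (c : ℂ)
    (B : Cn n →L[ℂ] Cn n) (v : Cn n × ℂ) :
    fderiv ℝ (lagrangeEquations f) ((z, c), B) (v, 0) = lagrangeDeriv (sqGrad B) f z c v := by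
  have h1 : HasFDerivAt (fun y => lagrangeEquations f (y, B))
      ((fderiv ℝ (lagrangeEquations f) ((z, c), B)).comp
        (ContinuousLinearMap.inl ℝ (Cn n × ℂ) (Cn n →L[ℂ] Cn n))) (z, c) :=
    HasFDerivAt.comp (z, c)
      (((contDiff_lagrangeEquations hf).differentiable (by simp)) _).hasFDerivAt
      (hasFDerivAt_prodMk_left (z, c) B)
  have h2 : HasFDerivAt (fun y => lagrangeEquations f (y, B))
      (lagrangeDeriv (sqGrad B) f z c) (z, c) := by
    have h3 := (hasFDerivAt_lagrange hf (sqGrad B) z c).sub_const ((0 : Cn n), (1 : ℂ))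
    refine h3.congr_of_eventuallyEq (Eventually.of_forall fun y => ?_)
    simp [lagrangeEquations]
  exact congrArg (fun A : Cn n × ℂ →L[ℝ] Cn n × ℂ => A v) (h1.unique h2)

lemma fderiv_lagrangeEquations_right (hf : ContDiff ℂ ∞ f) (z : Cn n) (c : ℂ)
    (B β : Cn n →L[ℂ] Cn n) :
    fderiv ℝ (lagrangeEquations f) ((z, c), B) (0, β) =
      ((2 : ℂ) • (ContinuousLinearMap.adjoint β (B z) + ContinuousLinearMap.adjoint B (β z)),
        0) := by
  have h0 : HasDerivAt (fun t : ℝ => B + t • β) β 0 := by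
    simpa using ((hasDerivAt_id (0 : ℝ)).smul_const β).const_add B
  have h1 : HasDerivAt (fun t : ℝ => lagrangeEquations f ((z, c), B + t • β))
      (fderiv ℝ (lagrangeEquations f) ((z, c), B) (0, β)) 0 := by
    have h2 : HasDerivAt (fun t : ℝ => ((z, c), B + t • β)) ((0 : Cn n × ℂ), β) 0 :=
      (hasDerivAt_const (0 : ℝ) (z, c)).prodMk h0
    have h3 : HasFDerivAt (lagrangeEquations f) (fderiv ℝ (lagrangeEquations f) ((z, c), B))
        ((z, c), B + (0 : ℝ) • β) := by
      rw [show B + (0 : ℝ) • β = B by ext; simp]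
      exact (((contDiff_lagrangeEquations hf).differentiable (by simp)) _).hasFDerivAt
    exact h3.comp_hasDerivAt (0 : ℝ) h2
  have h2 : HasDerivAt (fun t : ℝ => lagrangeEquations f ((z, c), B + t • β))
      ((2 : ℂ) • (ContinuousLinearMap.adjoint β (B z) + ContinuousLinearMap.adjoint B (β z)), 0)
      0 := by
    -- Along a line of operators the equations are quadratic in `t`; the derivative is the linear
    -- coefficient.
    have h3 : ∀ t : ℝ, lagrangeEquations f ((z, c), B + t • β) = lagrangeEquations f ((z, c), B) +
        (t • ((2 : ℂ) • (ContinuousLinearMap.adjoint β (B z) +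
            ContinuousLinearMap.adjoint B (β z)), (0 : ℂ)) +
          t ^ 2 • ((2 : ℂ) • ContinuousLinearMap.adjoint β (β z), (0 : ℂ))) := by
      intro t
      have h4 : sqGrad (B + t • β) z = sqGrad B z +
          (t • (2 : ℂ) • (ContinuousLinearMap.adjoint β (B z) + ContinuousLinearMap.adjoint B (β z))
            + t ^ 2 • (2 : ℂ) • ContinuousLinearMap.adjoint β (β z)) := by
        rw [sqGrad_apply, sqGrad_apply, map_add, map_smul, ← adjointReal_apply,
          ← adjointReal_apply]
        simp only [add_apply, smul_apply, map_add, smul_add, ContinuousLinearMap.map_smul_of_tower]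
        module
      simp only [lagrangeEquations, h4, Prod.smul_mk, Prod.mk_add_mk, smul_zero, add_zero]
      congr 1
      abel
    have h5 := ((((hasDerivAt_id (0 : ℝ)).smul_const (((2 : ℂ) •
      (ContinuousLinearMap.adjoint β (B z) + ContinuousLinearMap.adjoint B (β z)), (0 : ℂ)) :
        Cn n × ℂ)).add ((hasDerivAt_pow 2 (0 : ℝ)).smul_const
        (((2 : ℂ) • ContinuousLinearMap.adjoint β (β z), (0 : ℂ)) : Cn n × ℂ))).const_add
        (lagrangeEquations f ((z, c), B)))
    rw [funext h3]
    simpa using h5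
  exact h1.unique h2

/-- Lagrange's equations are transverse in the variables and the parameter together. -/
lemma surjective_fderiv_lagrangeEquations (hf : IsHomogeneousIntegral k f) (hk : k ≠ 0) {z : Cn n}
    (hz : f z = 1) (c : ℂ) {B B' : Cn n →L[ℂ] Cn n} (hB : ∀ z, B' (B z) = z) :
    Function.Surjective (fderiv ℝ (lagrangeEquations f) ((z, c), B)) := by
  rintro ⟨y, a⟩
  have hk' : (k : ℂ) ≠ 0 := Nat.cast_ne_zero.2 hk
  have hz0 : z ≠ 0 := by
    rintro rfl
    have h1 := hf.map_smul 0 0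
    rw [zero_pow hk, zero_mul, smul_zero, hz] at h1
    exact one_ne_zero h1
  have hzz : inner ℂ z z ≠ (0 : ℂ) := inner_self_ne_zero.2 hz0
  -- The radial `δ` attains the second component `a`, by Euler's identity; `α` then makes the
  -- remainder `x` orthogonal to `z`.
  set δ : Cn n := (a / k) • z with hδ
  have hfδ : fderiv ℂ f z δ = a := by
    rw [hδ, map_smul, hf.fderiv_self, hz, smul_eq_mul, mul_one, div_mul_cancel₀ _ hk']
  set r : Cn n := y - (sqGrad B δ - c • hessVec f z δ) with hr
  set α : ℂ := -inner ℂ z r / k with hα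
  set x : Cn n := r + α • grad f z with hx
  have hzx : inner ℂ z x = 0 := by
    have h1 : inner ℂ z (grad f z) = (k : ℂ) := by
      rw [← inner_conj_symm, inner_grad, hf.fderiv_self, hz, mul_one, Complex.conj_natCast]
    rw [hx, inner_add_right, inner_smul_right, h1, hα, div_mul_cancel₀ _ hk', add_neg_cancel]
  -- A rank one variation producing `x`: the adjoint of `β` kills `B z` because `x` is orthogonal to
  -- `z`, and the adjoint of `B` sends `β z` to `x / 2`.
  set β : Cn n →L[ℂ] Cn n := (innerSL ℂ z).smulRight
    ((1 / (2 * inner ℂ z z) : ℂ) • ContinuousLinearMap.adjoint B' x) with hβ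
  have hβapply : ∀ w, β w = inner ℂ z w •
      ((1 / (2 * inner ℂ z z) : ℂ) • ContinuousLinearMap.adjoint B' x) := fun w => rfl
  have h1 : ContinuousLinearMap.adjoint β (B z) = 0 := by
    refine ext_inner_right ℂ fun w => ?_
    rw [ContinuousLinearMap.adjoint_inner_left, hβapply, inner_smul_right, inner_smul_right,
      ContinuousLinearMap.adjoint_inner_right, hB, hzx]
    simp
  have h2 : ContinuousLinearMap.adjoint B (β z) = (1 / 2 : ℂ) • x := by
    refine ext_inner_right ℂ fun w => ?_
    rw [ContinuousLinearMap.adjoint_inner_left, hβapply, smul_smul, inner_smul_left,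
      ContinuousLinearMap.adjoint_inner_left, hB, inner_smul_left]
    congr 2
    field_simp
  refine ⟨((δ, α), β), ?_⟩
  have h3 : (((δ, α), β) : (Cn n × ℂ) × (Cn n →L[ℂ] Cn n)) = ((δ, α), 0) + (0, β) := by simp
  rw [h3, map_add, fderiv_lagrangeEquations_left hf.contDiff,
    fderiv_lagrangeEquations_right hf.contDiff, lagrangeDeriv_apply, h1, h2, hfδ, zero_add,
    smul_smul, Prod.mk_add_mk, add_zero]
  congr 1
  rw [show (2 : ℂ) * (1 / 2) = 1 by norm_num, one_smul, hx, hr]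
  abel

/-- The gradient scales by the conjugate of `μ ^ (k - 1)` and `T` by `μ`, which dictates the
multiplier at `μ • z`. -/
lemma LagrangeNondegenerate.of_smul (hf : IsHomogeneousIntegral k f) (hk : k ≠ 0)
    {T : Cn n →L[ℂ] Cn n} {z : Cn n} {c μ : ℂ} (hμ : μ ≠ 0)
    (h : LagrangeNondegenerate T f (μ • z) (μ * c / (starRingEnd ℂ) μ ^ (k - 1))) :
    LagrangeNondegenerate T f z c := by
  have hm : (starRingEnd ℂ) μ ^ (k - 1) ≠ 0 := pow_ne_zero _ ((map_ne_zero (starRingEnd ℂ)).2 hμ)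
  intro δ τ hδ hτ
  have h1 := h (μ • δ) (μ * τ / (starRingEnd ℂ) μ ^ (k - 1))
    (by rw [hf.fderiv_smul, hδ, mul_zero]) (by
      rw [hessVec_apply, hf.fderiv_fderiv_smul hμ hk, rieszReal_smul, ← hessVec_apply, grad,
        hf.fderiv_smul_eq hμ hk, rieszReal_smul, ← grad, map_pow, smul_smul, smul_smul,
        div_mul_cancel₀ _ hm, div_mul_cancel₀ _ hm, map_smul, mul_smul, ← smul_sub, hτ, smul_smul])
  exact (smul_eq_zero.1 h1).resolve_left hμ

/-- Close to the identity there are linear maps `B` such that all contacts of the foliation with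
`z ↦ Q (B z)` off the zero level satisfy Lagrange's condition. -/
theorem exists_lagrangeNondegenerate (hf : IsHomogeneousIntegral k f) (hk : k ≠ 0) :
    ∃ B B' : Cn n →L[ℂ] Cn n, ‖B - 1‖ ≤ 1 / 2 ∧ (∀ z, B' (B z) = z) ∧
      ∀ z c, f z ≠ 0 → sqGrad B z = c • grad f z → LagrangeNondegenerate (sqGrad B) f z c := by
  have hinv : ∀ B : Cn n →L[ℂ] Cn n, ‖B - 1‖ < 1 / 2 →
      ∃ B' : Cn n →L[ℂ] Cn n, ∀ z, B' (B z) = z := by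
    intro B hB
    have h1 : IsUnit (1 - (1 - B)) := isUnit_one_sub_of_norm_lt_one (by
      rw [norm_sub_rev]
      linarith)
    rw [sub_sub_cancel] at h1
    obtain ⟨u, rfl⟩ := h1
    refine ⟨((u⁻¹ : (Cn n →L[ℂ] Cn n)ˣ) : Cn n →L[ℂ] Cn n), fun z => ?_⟩
    exact congrArg (fun A : Cn n →L[ℂ] Cn n => A z) u.inv_mul
  set S : Set ((Cn n × ℂ) × (Cn n →L[ℂ] Cn n)) :=
    {x | lagrangeEquations f x = 0 ∧ ‖x.2 - 1‖ < 1 / 2} with hS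
  have hdense := dense_setOf_regular_parameter (Z := Cn n × ℂ) (T := Cn n × ℂ) rfl
    (contDiff_lagrangeEquations hf.contDiff) (S := S) (fun x hx => hx.1) (by
      rintro ⟨⟨z, c⟩, B⟩ ⟨hx, hB⟩
      obtain ⟨B', hB'⟩ := hinv B hB
      exact surjective_fderiv_lagrangeEquations hf hk (sub_eq_zero.1 (congrArg Prod.snd hx)) c hB')
  obtain ⟨B, hBgood, hBball⟩ := hdense.exists_mem_open
    (Metric.isOpen_ball (x := (1 : Cn n →L[ℂ] Cn n)) (ε := 1 / 2))
    ⟨1, Metric.mem_ball_self (by norm_num)⟩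
  have hB : ‖B - 1‖ < 1 / 2 := by rwa [Metric.mem_ball, dist_eq_norm] at hBball
  obtain ⟨B', hB'⟩ := hinv B hB
  refine ⟨B, B', hB.le, hB', fun z c hz hc => ?_⟩
  -- A `k`-th root moves the contact to the level `1`.
  obtain ⟨μ, hμ⟩ := IsAlgClosed.exists_pow_nat_eq (f z)⁻¹ (Nat.pos_of_ne_zero hk)
  have hμ0 : μ ≠ 0 := by
    rintro rfl
    rw [zero_pow hk] at hμ
    exact inv_ne_zero hz hμ.symm
  have hfμ : f (μ • z) = 1 := by rw [hf.map_smul, hμ, inv_mul_cancel₀ hz]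
  have hμz : μ • z ≠ 0 := by
    intro h
    have h1 := hf.map_smul 0 0
    rw [zero_pow hk, zero_mul, smul_zero, ← h, hfμ] at h1
    exact one_ne_zero h1
  refine LagrangeNondegenerate.of_smul hf hk hμ0
    ((injective_lagrangeDeriv_iff hf hμz).1 fun v hv => ?_)
  refine hBgood (μ • z, μ * c / (starRingEnd ℂ) μ ^ (k - 1)) ⟨?_, hB⟩ v ?_
  · have hm : (starRingEnd ℂ) μ ^ (k - 1) ≠ 0 :=
      pow_ne_zero _ ((map_ne_zero (starRingEnd ℂ)).2 hμ0)
    rw [lagrangeEquations]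
    simp only
    rw [hfμ, sub_self, map_smul, hc, grad, grad, hf.fderiv_smul_eq hμ0 hk, rieszReal_smul, map_pow,
      smul_smul, smul_smul, div_mul_cancel₀ _ hm, sub_self]
    rfl
  · rw [fderiv_lagrangeEquations_left hf.contDiff, hv]

end Generic

lemma isMorseIndexZero_Q_comp {n : ℕ} {B : Cn n →L[ℂ] Cn n} (hB : ∀ z, B z = 0 → z = 0) :
    IsMorseIndexZero fun z => Q (B z) := by
  have hself : ∀ z, reInner n (sqGrad B z) z = 2 * ‖B z‖ ^ 2 := fun z => by
    rw [reInner_apply, inner_sqGrad, ← Q_eq_norm_sq, Q_eq_re_inner]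
    simp
  have hfd : fderiv ℝ (fun z => Q (B z)) = fun z => reInner n (sqGrad B z) :=
    funext fun z => (hasFDerivAt_Q_comp B z).fderiv
  refine ⟨?_, fun z => ⟨fun h => ?_, ?_⟩, fun v hv => ?_⟩
  · have h1 : ContDiff ℝ ω fun z : Cn n => ‖B z‖ ^ 2 :=
      (contDiff_norm_sq ℂ).comp (B.restrictScalars ℝ).contDiff
    simp_rw [Q_eq_norm_sq]
    exact fun z _ => h1.contDiffAt.analyticAt
  · rw [hfd] at h
    have h1 := hself z
    simp only at h
    rw [h] at h1
    exact hB z (by simpa using h1.symm)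
  · rintro rfl
    rw [hfd]
    simp
  · have h1 : hessian (fun z => Q (B z)) 0 = (reInner n).comp ((sqGrad B).restrictScalars ℝ) := by
      rw [hessian, hfd]
      exact ((reInner n).comp ((sqGrad B).restrictScalars ℝ)).hasFDerivAt.fderiv
    have h2 : hessian (fun z => Q (B z)) 0 v v = 2 * ‖B v‖ ^ 2 := by
      rw [h1, ← hself v]
      rfl
    rw [h2]
    have h3 : 0 < ‖B v‖ := norm_pos_iff.2 fun h => hv (hB v h)
    positivity

/-- The segment from the identity to `B` is a perturbation by `t • (B - 1)`. -/
lemma isotopicToQ_Q_comp {n : ℕ} {B : Cn n →L[ℂ] Cn n} (hB : ‖B - 1‖ ≤ 1 / 2) :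
    IsotopicToQ fun z => Q (B z) := by
  refine ⟨fun t z => z + t • (B - 1) z, isIsotopy_perturbation isClosed_empty ?_ (map_zero _) ?_
    (by simp), fun z => ?_⟩
  · exact (B - 1).lipschitz.weaken hB
  · exact ((B - 1).restrictScalars ℝ).contDiff.contDiffOn
  · simp

/-- An isotopy whose final map pulls one first integral back to another pulls back compatible Morse
structures. -/
theorem IsIsotopy.carriesMorseStructure {n : ℕ} {Φ : ℝ → Cn n → Cn n} (h : IsIsotopy {0} Φ)
    {f f' : Cn n → ℂ} (hf : Differentiable ℂ f) (hf' : Differentiable ℂ f')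
    (hff' : ∀ z, f' (Φ 1 z) = f z) {g : Cn n → ℝ} (hg : CarriesMorseStructure f' g) :
    CarriesMorseStructure f fun z => g (Φ 1 z) := by
  have hcarry := h.carriesFoliation hff'
  obtain ⟨-, hfix, Ψ, hinv, -, -, hs, hsΨ⟩ := h
  have h1 : (1 : ℝ) ∈ Icc (0 : ℝ) 1 := by simp
  have hne : ∀ z, z ≠ 0 → Φ 1 z ≠ 0 := fun z hz h => hz <|
    (hinv 1 h1).1.injective (h.trans (hfix 1 h1).symm)
  have hslice : ContDiff ℝ ∞ fun z : Cn n => ((1 : ℝ), z) := contDiff_const.prodMk contDiff_id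
  have hΦs : ContDiffOn ℝ ∞ (Φ 1) {0}ᶜ :=
    hs.comp hslice.contDiffOn fun z hz => ⟨h1, hz⟩
  have hΨs : ContDiffOn ℝ ∞ (Ψ 1) {0}ᶜ :=
    hsΨ.comp hslice.contDiffOn fun z hz => ⟨h1, hz⟩
  have hopen : ∀ z : Cn n, z ≠ 0 → ({0}ᶜ : Set (Cn n)) ∈ 𝓝 z := fun z hz =>
    isOpen_compl_singleton.mem_nhds hz
  have hΦd : ∀ z, z ≠ 0 → HasFDerivAt (Φ 1) (fderiv ℝ (Φ 1) z) z := fun z hz =>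
    ((hΦs.contDiffAt (hopen z hz)).differentiableAt (by simp)).hasFDerivAt
  have hΨd : ∀ z, z ≠ 0 → HasFDerivAt (Ψ 1) (fderiv ℝ (Ψ 1) z) z := fun z hz =>
    ((hΨs.contDiffAt (hopen z hz)).differentiableAt (by simp)).hasFDerivAt
  have hleft : ∀ z, z ≠ 0 → ∀ v, fderiv ℝ (Ψ 1) (Φ 1 z) (fderiv ℝ (Φ 1) z v) = v := by
    intro z hz v
    have h2 := (hΨd _ (hne z hz)).comp z (hΦd z hz)
    have h3 := h2.unique ((hasFDerivAt_id z).congr_of_eventuallyEq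
      (Eventually.of_forall (hinv 1 h1).1))
    exact congrArg (fun A : Cn n →L[ℝ] Cn n => A v) h3
  have hright : ∀ z, z ≠ 0 → ∀ v, fderiv ℝ (Φ 1) z (fderiv ℝ (Ψ 1) (Φ 1 z) v) = v := by
    intro z hz v
    have h2 : HasFDerivAt (fun w => Φ 1 (Ψ 1 w))
        ((fderiv ℝ (Φ 1) z).comp (fderiv ℝ (Ψ 1) (Φ 1 z))) (Φ 1 z) := by
      refine HasFDerivAt.comp (Φ 1 z) ?_ (hΨd _ (hne z hz))
      rw [(hinv 1 h1).1 z]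
      exact hΦd z hz
    have h3 := h2.unique ((hasFDerivAt_id (Φ 1 z)).congr_of_eventuallyEq
      (Eventually.of_forall (hinv 1 h1).2))
    exact congrArg (fun A : Cn n →L[ℝ] Cn n => A v) h3
  have hdf : ∀ z, z ≠ 0 → ∀ v, fderiv ℂ f z v = fderiv ℂ f' (Φ 1 z) (fderiv ℝ (Φ 1) z v) := by
    intro z hz v
    have h2 : HasFDerivAt (fun w => f' (Φ 1 w))
        (((fderiv ℂ f' (Φ 1 z)).restrictScalars ℝ).comp (fderiv ℝ (Φ 1) z)) z :=
      HasFDerivAt.comp z ((hf' (Φ 1 z)).hasFDerivAt.restrictScalars ℝ) (hΦd z hz)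
    have h3 : HasFDerivAt (fun w => f' (Φ 1 w)) ((fderiv ℂ f z).restrictScalars ℝ) z := by
      rw [funext hff']
      exact (hf z).hasFDerivAt.restrictScalars ℝ
    exact congrArg (fun A : Cn n →L[ℝ] ℂ => A v) (h3.unique h2)
  have hcontact : ∀ z, z ≠ 0 → IsContact f (fun z => g (Φ 1 z)) z → IsContact f' g (Φ 1 z) := by
    intro z hz hct v hv
    have hgd : HasFDerivAt g (fderiv ℝ g (Φ 1 z)) (Φ 1 z) :=
      ((hg.1.contDiffAt (hopen _ (hne z hz))).differentiableAt (by simp)).hasFDerivAt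
    have h2 := hct (fderiv ℝ (Ψ 1) (Φ 1 z) v) (by rw [hdf z hz, hright z hz, hv])
    have h3 : HasFDerivAt (fun z => g (Φ 1 z)) _ z := hgd.comp z (hΦd z hz)
    rw [h3.fderiv, ContinuousLinearMap.comp_apply, hright z hz] at h2
    exact h2
  have hnondeg : ∀ z, z ≠ 0 → IsNondegenerateOnLeaf f' g (Φ 1 z) →
      IsNondegenerateOnLeaf f (fun z => g (Φ 1 z)) z := by
    rintro z hz hnd φ ⟨hφ0, hφs, hφi, hφc⟩ u hu
    have hΦz : ContDiffAt ℝ ∞ (Φ 1) (φ 0) := by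
      rw [hφ0]
      exact hΦs.contDiffAt (hopen z hz)
    -- Composition with `Φ 1` turns leaf charts of `f` into leaf charts of `f'`, and the function in
    -- the chart is unchanged.
    refine hnd (Φ 1 ∘ φ) ⟨by simp [hφ0], hΦz.comp 0 hφs, ?_, ?_⟩ u hu
    · have h2 : HasFDerivAt (Φ 1 ∘ φ) ((fderiv ℝ (Φ 1) z).comp (fderiv ℝ φ 0)) 0 := by
        refine HasFDerivAt.comp 0 ?_ (hφs.differentiableAt (by simp)).hasFDerivAt
        rw [hφ0]
        exact hΦd z hz
      rw [h2.fderiv]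
      exact (Function.LeftInverse.injective (hleft z hz)).comp hφi
    · filter_upwards [hφc] with y hy
      rw [Function.comp_apply, hff', hff', hy]
  refine ⟨hg.1.comp hΦs hne, fun L hL => ?_⟩
  have hL0 : ∀ z ∈ L, z ≠ 0 := by
    obtain ⟨z₀, -, rfl⟩ := hL
    exact fun z hz => (connectedComponentIn_subset {w | w ≠ 0 ∧ f w = f z₀} z₀ hz).1
  obtain ⟨hiso, hnd⟩ := hg.2 (Φ 1 '' L) (by
    rw [← hcarry]
    exact ⟨L, hL, rfl⟩)
  refine ⟨fun z hz hct => ?_, fun z hz hct => ?_⟩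
  · obtain ⟨ε, hε, hεw⟩ := hiso _ ⟨z, hz, rfl⟩ (hcontact z (hL0 z hz) hct)
    exact ⟨ε, hε, fun w hw hwct => hεw _ ⟨w, hw, rfl⟩ (hcontact w (hL0 w hw) hwct)⟩
  · exact hnondeg z (hL0 z hz) (hnd _ ⟨z, hz, rfl⟩ (hcontact z (hL0 z hz) hct))

end HolFol

/-! ### Polynomial first integrals and the Fermat foliation. -/

namespace HolFol
open Set Filter Topology

section Polynomials

variable {n k : ℕ}

lemma hasFDerivAt_polyFun (p : MvPolynomial (Fin n) ℂ) (z : Cn n) :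
    HasFDerivAt (polyFun p) (∑ j, polyFun (MvPolynomial.pderiv j p) z •
      (EuclideanSpace.proj j : Cn n →L[ℂ] ℂ)) z := by
  induction p using MvPolynomial.induction_on with
  | C a =>
    have h1 : polyFun (n := n) (MvPolynomial.C a) = fun _ => a := by
      funext w
      simp [polyFun]
    rw [h1]
    refine (hasFDerivAt_const a z).congr_fderiv ?_
    refine (Finset.sum_eq_zero fun j _ => ?_).symm
    ext v
    simp [polyFun]
  | add p q hp hq =>
    have h1 : polyFun (p + q) = fun w => polyFun p w + polyFun q w := by
      funext w
      simp [polyFun]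
    rw [h1]
    refine (hp.add hq).congr_fderiv ?_
    rw [← Finset.sum_add_distrib]
    refine Finset.sum_congr rfl fun j _ => ?_
    rw [← add_smul]
    simp [polyFun]
  | mul_X p i hp =>
    have h1 : polyFun (p * MvPolynomial.X i) =
        fun w => polyFun p w * (EuclideanSpace.proj i : Cn n →L[ℂ] ℂ) w := by
      funext w
      simp [polyFun]
    rw [h1]
    refine (hp.mul (EuclideanSpace.proj i : Cn n →L[ℂ] ℂ).hasFDerivAt).congr_fderiv ?_
    ext v
    have h2 : ∀ j, polyFun (MvPolynomial.pderiv j (p * MvPolynomial.X i)) z * v j =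
        z i * (polyFun (MvPolynomial.pderiv j p) z * v j) +
          if j = i then polyFun p z * v j else 0 := by
      intro j
      rcases eq_or_ne j i with rfl | hij
      · simp only [polyFun, MvPolynomial.pderiv_mul, MvPolynomial.pderiv_X_self, map_add, map_mul,
          MvPolynomial.eval_X, map_one, if_true]
        ring
      · simp only [polyFun, MvPolynomial.pderiv_mul, MvPolynomial.pderiv_X_of_ne hij.symm, map_add,
          map_mul, MvPolynomial.eval_X, map_zero, if_neg hij]
        ring
    calc (polyFun p z • (EuclideanSpace.proj i : Cn n →L[ℂ] ℂ) +
          (EuclideanSpace.proj i : Cn n →L[ℂ] ℂ) z • ∑ j, polyFun (MvPolynomial.pderiv j p) z •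
            (EuclideanSpace.proj j : Cn n →L[ℂ] ℂ)) v
        = polyFun p z * v i + z i * ∑ j, polyFun (MvPolynomial.pderiv j p) z * v j := by
          rw [add_apply, smul_apply, smul_apply, sum_apply]
          rfl
      _ = ∑ j, polyFun (MvPolynomial.pderiv j (p * MvPolynomial.X i)) z * v j := by
          simp only [h2, Finset.sum_add_distrib, Finset.sum_ite_eq', Finset.mem_univ, if_true,
            Finset.mul_sum]
          rw [add_comm]
      _ = _ := by
          rw [sum_apply]
          rfl

lemma contDiff_polyFun (p : MvPolynomial (Fin n) ℂ) : ContDiff ℂ ∞ (polyFun p) := by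
  have h1 : polyFun p = fun z : Cn n => ∑ d ∈ p.support, p.coeff d * ∏ i, z i ^ d i := by
    funext z
    rw [polyFun, MvPolynomial.eval_eq']
  rw [h1]
  refine ContDiff.sum fun d _ => contDiff_const.mul (contDiff_prod fun i _ => ContDiff.pow ?_ _)
  exact (EuclideanSpace.proj i : Cn n →L[ℂ] ℂ).contDiff

lemma fderiv_polyFun_apply (p : MvPolynomial (Fin n) ℂ) (z v : Cn n) :
    fderiv ℂ (polyFun p) z v = ∑ j, polyFun (MvPolynomial.pderiv j p) z * v j := by
  rw [(hasFDerivAt_polyFun p z).fderiv, sum_apply]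
  rfl

lemma fderiv_polyFun_single (p : MvPolynomial (Fin n) ℂ) (z : Cn n) (j : Fin n) :
    fderiv ℂ (polyFun p) z (EuclideanSpace.single j 1) = polyFun (MvPolynomial.pderiv j p) z := by
  rw [fderiv_polyFun_apply, Finset.sum_eq_single j]
  · simp
  · intro i _ hij
    simp [hij]
  · simp

lemma fderiv_fderiv_polyFun_single (p : MvPolynomial (Fin n) ℂ) (z δ : Cn n) (j : Fin n) :
    fderiv ℂ (fderiv ℂ (polyFun p)) z δ (EuclideanSpace.single j 1) =
      fderiv ℂ (polyFun (MvPolynomial.pderiv j p)) z δ := by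
  have h1 : HasFDerivAt (fderiv ℂ (polyFun p)) (fderiv ℂ (fderiv ℂ (polyFun p)) z) z :=
    (((contDiff_polyFun p).fderiv_right (m := ∞) (by simp)).differentiable (by simp) z).hasFDerivAt
  have h2 := h1.clm_apply (hasFDerivAt_const (EuclideanSpace.single j (1 : ℂ)) z)
  have h3 : (fun w => fderiv ℂ (polyFun p) w (EuclideanSpace.single j 1)) =
      polyFun (MvPolynomial.pderiv j p) := funext fun w => fderiv_polyFun_single p w j
  rw [h3] at h2
  rw [h2.fderiv]
  simp

lemma polyFun_smul {p : MvPolynomial (Fin n) ℂ} (hp : p.IsHomogeneous k) (μ : ℂ) (z : Cn n) :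
    polyFun p (μ • z) = μ ^ k * polyFun p z := by
  rw [polyFun, polyFun, MvPolynomial.eval_eq', MvPolynomial.eval_eq', Finset.mul_sum]
  refine Finset.sum_congr rfl fun d hd => ?_
  have h1 : ∏ i, (μ • z) i ^ d i = μ ^ k * ∏ i, z i ^ d i := by
    simp only [PiLp.smul_apply, smul_eq_mul, mul_pow, Finset.prod_mul_distrib]
    rw [Finset.prod_pow_eq_pow_sum, hp.degree_eq_sum_deg_support hd,
      Finset.sum_subset (Finset.subset_univ d.support)
        fun i _ hi => Finsupp.notMem_support_iff.1 hi]
  rw [h1]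
  ring

lemma isHomogeneousIntegral_polyFun {h : MvPolynomial (Fin n) ℂ} (hhom : h.IsHomogeneous k)
    (hcrit : HasUniqueCriticalPointZero h) : IsHomogeneousIntegral k (polyFun h) where
  contDiff := contDiff_polyFun h
  map_smul := polyFun_smul hhom
  fderiv_ne_zero z hz h0 := hz <| (hcrit z).1 fun j => by
    have := fderiv_polyFun_single h z j
    rw [h0] at this
    exact this.symm

lemma rieszReal_coord (l : Cn n →L[ℂ] ℂ) (i : Fin n) :
    rieszReal n l i = (starRingEnd ℂ) (l (EuclideanSpace.single i 1)) := by
  rw [← inner_rieszReal, EuclideanSpace.inner_single_right]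
  simp

lemma isHomogeneous_fermat : (fermat n k).IsHomogeneous k :=
  MvPolynomial.IsHomogeneous.sum _ _ _ fun i _ => MvPolynomial.isHomogeneous_X_pow i k

lemma polyFun_pderiv_fermat (j : Fin n) (z : Cn n) :
    polyFun (MvPolynomial.pderiv j (fermat n k)) z = k * z j ^ (k - 1) := by
  rw [fermat, map_sum, Finset.sum_eq_single j]
  · simp [polyFun]
  · intro i _ hij
    simp [MvPolynomial.pderiv_X_of_ne hij]
  · simp

lemma hasUniqueCriticalPointZero_fermat (hk : 2 ≤ k) : HasUniqueCriticalPointZero (fermat n k) := by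
  have hk0 : (k : ℂ) ≠ 0 := Nat.cast_ne_zero.2 (by omega)
  intro z
  constructor
  · intro h
    ext j
    have h1 := (polyFun_pderiv_fermat j z).symm.trans (h j)
    exact eq_zero_of_pow_eq_zero ((mul_eq_zero.1 h1).resolve_left hk0)
  · rintro rfl j
    refine (polyFun_pderiv_fermat j 0).trans ?_
    rw [PiLp.zero_apply, zero_pow (by omega), mul_zero]

lemma polyFun_fermat (z : Cn n) : polyFun (fermat n k) z = ∑ i, z i ^ k := by
  simp [polyFun, fermat]

lemma fderiv_polyFun_pderiv_fermat (j : Fin n) (z δ : Cn n) :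
    fderiv ℂ (polyFun (MvPolynomial.pderiv j (fermat n k))) z δ =
      k * ((k - 1 : ℕ) * z j ^ (k - 2) * δ j) := by
  have h1 : polyFun (MvPolynomial.pderiv j (fermat n k)) =
      fun w : Cn n => (k : ℂ) * (EuclideanSpace.proj j : Cn n →L[ℂ] ℂ) w ^ (k - 1) :=
    funext fun w => polyFun_pderiv_fermat j w
  rw [h1, (((EuclideanSpace.proj j : Cn n →L[ℂ] ℂ).hasFDerivAt.pow (k - 1)).const_mul
    (k : ℂ)).fderiv]
  simp [Nat.sub_sub]

/-- The contacts of the Fermat foliation with the round spheres satisfy Lagrange's condition. -/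
lemma lagrangeNondegenerate_fermat (hk : 2 < k) {z : Cn n} {c : ℂ}
    (hz : polyFun (fermat n k) z ≠ 0) (hc : sqGrad 1 z = c • grad (polyFun (fermat n k)) z) :
    LagrangeNondegenerate (sqGrad 1) (polyFun (fermat n k)) z c := by
  obtain ⟨m, rfl⟩ : ∃ m, k = m + 2 := ⟨k - 2, by omega⟩
  have hm : m ≠ 0 := by omega
  have hT : ∀ (w : Cn n) i, sqGrad 1 w i = 2 * w i := by
    intro w i
    have h1 : sqGrad 1 w = (2 : ℂ) • w := by
      refine ext_inner_right ℂ fun v => ?_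
      rw [inner_sqGrad, inner_smul_left, Complex.conj_ofNat]
      rfl
    rw [h1]
    rfl
  set K : ℂ := ((m + 2 : ℕ) : ℂ) with hK
  have hKc : (starRingEnd ℂ) K = K := Complex.conj_natCast _
  have hK0 : K ≠ 0 := Nat.cast_ne_zero.2 (by omega)
  have hgrad : ∀ i, grad (polyFun (fermat n (m + 2))) z i
      = K * (starRingEnd ℂ) (z i) ^ (m + 1) := by
    intro i
    rw [grad, rieszReal_coord, fderiv_polyFun_single, polyFun_pderiv_fermat, map_mul, hKc, map_pow]
    rfl
  have hhess : ∀ δ i, hessVec (polyFun (fermat n (m + 2))) z δ i =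
      K * ((m + 1 : ℕ) * (starRingEnd ℂ) (z i) ^ m * (starRingEnd ℂ) (δ i)) := by
    intro δ i
    rw [hessVec_apply, rieszReal_coord, fderiv_fderiv_polyFun_single, fderiv_polyFun_pderiv_fermat,
      map_mul, hKc, map_mul, map_mul, map_pow, Complex.conj_natCast]
    rfl
  have e1 : ∀ i, 2 * z i = c * (K * (starRingEnd ℂ) (z i) ^ (m + 1)) := by
    intro i
    rw [← hT, hc, PiLp.smul_apply, hgrad, smul_eq_mul]
  intro δ τ hδ hτ
  have e2 : ∀ i, 2 * δ i -
      c * (K * ((m + 1 : ℕ) * (starRingEnd ℂ) (z i) ^ m * (starRingEnd ℂ) (δ i))) =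
      τ * (K * (starRingEnd ℂ) (z i) ^ (m + 1)) := by
    intro i
    have h1 := congrArg (fun w : Cn n => w i) hτ
    simp only [PiLp.sub_apply, PiLp.smul_apply, smul_eq_mul, hT, hhess, hgrad] at h1
    exact h1
  have e3 : ∑ i, z i ^ (m + 1) * δ i = 0 := by
    rw [fderiv_polyFun_apply] at hδ
    simp only [polyFun_pderiv_fermat, mul_assoc] at hδ
    rw [← Finset.mul_sum] at hδ
    exact (mul_eq_zero.1 hδ).resolve_left hK0
  have e1' : ∀ i, 2 * (starRingEnd ℂ) (z i) = (starRingEnd ℂ) c * (K * z i ^ (m + 1)) := by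
    intro i
    have h1 := congrArg (starRingEnd ℂ) (e1 i)
    simpa [hKc, Complex.conj_ofNat] using h1
  have e3' : ∑ i, (starRingEnd ℂ) (z i) ^ (m + 1) * (starRingEnd ℂ) (δ i) = 0 := by
    have h1 := congrArg (starRingEnd ℂ) e3
    simpa using h1
  -- The linearized equations are summed against the conjugates of the `z i`. By the contact
  -- equations and tangency everything cancels except `τ * K` times the conjugate of the nonzero
  -- value of the polynomial.
  have hτ0 : τ = 0 := by
    have h1 : ∑ i, (starRingEnd ℂ) (z i) * (τ * (K * (starRingEnd ℂ) (z i) ^ (m + 1))) = 0 := by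
      calc ∑ i, (starRingEnd ℂ) (z i) * (τ * (K * (starRingEnd ℂ) (z i) ^ (m + 1)))
          = ∑ i, ((starRingEnd ℂ) c * K * (z i ^ (m + 1) * δ i) - c * K * (m + 1 : ℕ) *
            ((starRingEnd ℂ) (z i) ^ (m + 1) * (starRingEnd ℂ) (δ i))) := by
            refine Finset.sum_congr rfl fun i _ => ?_
            rw [← e2 i]
            linear_combination δ i * e1' i
        _ = 0 := by
            rw [Finset.sum_sub_distrib, ← Finset.mul_sum, ← Finset.mul_sum, e3, e3', mul_zero,
              mul_zero, sub_zero]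
    have h2 : τ * K * (starRingEnd ℂ) (polyFun (fermat n (m + 2)) z) = 0 := by
      rw [← h1, polyFun_fermat, map_sum, Finset.mul_sum]
      refine Finset.sum_congr rfl fun i _ => ?_
      rw [map_pow]
      ring
    rcases mul_eq_zero.1 h2 with h3 | h3
    · exact (mul_eq_zero.1 h3).resolve_right hK0
    · exact absurd ((map_eq_zero (starRingEnd ℂ)).1 h3) hz
  ext i
  rw [PiLp.zero_apply]
  have h2 := e2 i
  rw [hτ0, zero_mul, sub_eq_zero] at h2
  -- With `τ = 0` the coordinates decouple. If `z i = 0`, the term in the conjugate of `δ i`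
  -- vanishes because `m = k - 2` is positive. Otherwise, taking norms in both equations gives `‖δ
  -- i‖ = (m + 1) * ‖δ i‖`, and `m ≠ 0` again forces `δ i = 0`.
  by_cases hzi : z i = 0
  · rw [hzi, map_zero, zero_pow hm] at h2
    simpa using h2
  · have n1 : 2 * ‖z i‖ = ‖c‖ * ((m + 2 : ℕ) * ‖z i‖ ^ (m + 1)) := by
      have h3 := congrArg norm (e1 i)
      simpa only [norm_mul, norm_pow, RCLike.norm_conj, Complex.norm_ofNat, hK,
        Complex.norm_natCast] using h3
    have n2 : 2 * ‖δ i‖ = ‖c‖ * ((m + 2 : ℕ) * ((m + 1 : ℕ) * ‖z i‖ ^ m * ‖δ i‖)) := by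
      have h3 := congrArg norm h2
      simpa only [norm_mul, norm_pow, RCLike.norm_conj, Complex.norm_ofNat, hK,
        Complex.norm_natCast] using h3
    have hzn : ‖z i‖ ≠ 0 := norm_ne_zero_iff.2 hzi
    have n3 : 2 = ‖c‖ * ((m + 2 : ℕ) * ‖z i‖ ^ m) := by
      apply mul_right_cancel₀ hzn
      rw [n1]
      ring
    have n4 : 2 * ‖δ i‖ = 2 * ((m + 1 : ℕ) * ‖δ i‖) := by
      rw [n2]
      linear_combination (-((m + 1 : ℕ) * ‖δ i‖)) * n3
    have n5 : (m : ℝ) * ‖δ i‖ = 0 := by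
      push_cast at n4
      linarith
    have hm' : (m : ℝ) ≠ 0 := Nat.cast_ne_zero.2 hm
    exact norm_eq_zero.1 ((mul_eq_zero.1 n5).resolve_left hm')

/-- Homogeneous polynomials of the same degree with no critical point but the origin are
isotopic. -/
theorem exists_isIsotopy_polyFun (hk : 2 ≤ k) {p q : MvPolynomial (Fin n) ℂ}
    (hp : p.IsHomogeneous k) (hq : q.IsHomogeneous k) (hp' : HasUniqueCriticalPointZero p)
    (hq' : HasUniqueCriticalPointZero q) :
    ∃ Φ : ℝ → Cn n → Cn n, IsIsotopy {0} Φ ∧ ∀ z, polyFun q (Φ 1 z) = polyFun p z := by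
  have Hp := isHomogeneousIntegral_polyFun hp hp'
  have Hq := isHomogeneousIntegral_polyFun hq hq'
  -- The parameter is complex so that removing finitely many values leaves a connected set.
  set f : ℂ → Cn n → ℂ := fun s z => polyFun p z + s * polyFun (q - p) z with hf
  have hsub : ∀ z, polyFun (q - p) z = polyFun q z - polyFun p z := fun z => by simp [polyFun]
  have hfd : ∀ s z j, fderiv ℂ (f s) z (EuclideanSpace.single j 1) =
      polyFun (MvPolynomial.pderiv j p) z + s * polyFun (MvPolynomial.pderiv j (q - p)) z := by
    intro s z j
    have h1 : HasFDerivAt (f s) (fderiv ℂ (polyFun p) z + s • fderiv ℂ (polyFun (q - p)) z) z :=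
      (((contDiff_polyFun p).differentiable (by simp) z).hasFDerivAt).add
        ((((contDiff_polyFun (q - p)).differentiable (by simp) z).hasFDerivAt).const_mul s)
    rw [h1.fderiv, add_apply, smul_apply, fderiv_polyFun_single, fderiv_polyFun_single, smul_eq_mul]
  have hf0 : f 0 = polyFun p := by
    funext z
    simp [hf]
  have hf1 : f 1 = polyFun q := by
    funext z
    simp [hf, hsub]
  have hcount : {s | ∃ z, z ≠ 0 ∧ fderiv ℂ (f s) z = 0}.Countable := by
    refine ((finite_setOf_exists_common_zero (fun j => MvPolynomial.pderiv j p)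
      (fun j => MvPolynomial.pderiv j (q - p)) (fun j => hp.pderiv)
      (fun j => (hq.sub hp).pderiv) fun z hz => ?_).subset ?_).countable
    · have h1 := (hp' (WithLp.toLp 2 z)).1 hz
      exact congrArg (fun w : Cn n => (w : Fin n → ℂ)) h1
    · rintro s ⟨z, hz, hs⟩
      refine ⟨fun i => z i, fun h => hz (by ext i; exact congrFun h i), fun j => ?_⟩
      have h1 := hfd s z j
      rw [hs] at h1
      exact h1.symm
  have hres := exists_isIsotopy_of_countable (k := k) (f := f) (s := 0) (s' := 1) (by omega) ?_ ?_
    ?_ hcount (by rw [hf0]; exact Hp.fderiv_ne_zero) (by rw [hf1]; exact Hq.fderiv_ne_zero)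
  · rwa [hf0, hf1] at hres
  · have h1 : ContDiff ℝ ∞ (polyFun p) := (contDiff_polyFun p).restrict_scalars ℝ
    have h2 : ContDiff ℝ ∞ (polyFun (q - p)) := (contDiff_polyFun (q - p)).restrict_scalars ℝ
    exact (h1.comp contDiff_snd).add (contDiff_fst.mul (h2.comp contDiff_snd))
  · intro s r z
    have h1 : r • z = (r : ℂ) • z := rfl
    simp only [hf]
    rw [h1, polyFun_smul hp, polyFun_smul (hq.sub hp)]
    ring
  · exact fun s => (contDiff_polyFun p).add (contDiff_const.mul (contDiff_polyFun (q - p)))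

end Polynomials

end HolFol

theorem mainTheorem6 (n k : ℕ) (hn : 2 ≤ n) (hk : 2 < k)
    (h : MvPolynomial (Fin n) ℂ) (hhom : h.IsHomogeneous k)
    (hcrit : HolFol.HasUniqueCriticalPointZero h) :
    (∃ Φ : ℝ → HolFol.Cn n → HolFol.Cn n,
      HolFol.IsIsotopy {0} Φ ∧
      HolFol.CarriesFoliation (Φ 1) (HolFol.foliation (HolFol.polyFun h))
        (HolFol.foliation (HolFol.polyFun (HolFol.fermat n k))) ∧
      HolFol.CarriesMorseStructure (HolFol.polyFun h) (fun z => HolFol.Q (Φ 1 z))) ∧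
    ∃ g : HolFol.Cn n → ℝ,
      HolFol.IsMorseIndexZero g ∧ HolFol.IsotopicToQ g ∧
      HolFol.CarriesMorseStructure (HolFol.polyFun h) g := by
  have hk0 : k ≠ 0 := by omega
  have hfermat := HolFol.hasUniqueCriticalPointZero_fermat (n := n) (k := k) (by omega)
  have Hh := HolFol.isHomogeneousIntegral_polyFun hhom hcrit
  have HF := HolFol.isHomogeneousIntegral_polyFun HolFol.isHomogeneous_fermat hfermat
  constructor
  · obtain ⟨Φ, hΦ, hΦf⟩ := HolFol.exists_isIsotopy_polyFun (by omega) hhom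
      HolFol.isHomogeneous_fermat hcrit hfermat
    refine ⟨Φ, hΦ, hΦ.carriesFoliation hΦf,
      hΦ.carriesMorseStructure Hh.differentiable HF.differentiable hΦf ?_⟩
    -- The round form needs no perturbation for the Fermat foliation.
    exact HolFol.carriesMorseStructure_of_lagrangeNondegenerate (B := 1) (B' := 1) HF hk0
      (fun z => rfl) fun z c hz hc => HolFol.lagrangeNondegenerate_fermat hk hz hc
  · obtain ⟨B, B', hB, hB', hnd⟩ := HolFol.exists_lagrangeNondegenerate Hh hk0
    have hB0 : ∀ z, B z = 0 → z = 0 := fun z hz => by rw [← hB' z, hz, map_zero]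
    exact ⟨fun z => HolFol.Q (B z), HolFol.isMorseIndexZero_Q_comp hB0,
      HolFol.isotopicToQ_Q_comp hB,
      HolFol.carriesMorseStructure_of_lagrangeNondegenerate Hh hk0 hB' hnd⟩
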